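/- **Definitions.** A function $F:[0,\infty]^4\to[0,\infty]$ is *admissible* if it is weakly increasing for the product order and $x l_y+y l_x\le F(x,y,l_x,l_y)$ for all $x,y,l_x,l_y$. An *$F$-quasi-Leibniz quantum compact metric space* is a pair $(A,L)$ of a nonzero unital C*-algebra $A$ and a seminorm $L$ defined on a dense Jordan–Lie subalgebra $\mathrm{dom}(L)$ of the self-adjoint part $\mathrm{sa}(A)$ (i.e. a dense real subspace closed under $a\circ b=\frac{ab+ba}{2}$ and $\{a,b\}=\frac{ab-ba}{2i}$) such that: $\{a: L(a)=0\}=\mathbb{R}1_A$; the Monge–Kantorovich metric $\mathsf{mk}_L(\varphi,\psi)=\sup\{|\varphi(a)-\psi(a)|: a\in\mathrm{dom}(L),\,L(a)\le1\}$ metrizes the weak* topology of the state space $\mathscr{S}(A)$; $\max\{L(a\circ b),L(\{a,b\})\}\le F(\|a\|,\|b\|,L(a),L(b))$ for $a,b\in\mathrm{dom}(L)$; and $L$, extended by $\infty$ outside $\mathrm{dom}(L)$, is norm lower semicontinuous. A *quantum isometry* $\pi:(A,L_A)\to(B,L_B)$ is a surjective *-homomorphism with $L_B(b)=\inf\{L_A(a):\pi(a)=b\}$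 for all $b\in\mathrm{sa}(B)$; a *full quantum isometry* is a *-isomorphism $h$ with $L_B\circ h=L_A$. An *$F$-tunnel* $\tau=(E,L_E,\pi_A,\pi_B)$ from $(A,L_A)$ to $(B,L_B)$ is an $F$-quasi-Leibniz quantum compact metric space $(E,L_E)$ with quantum isometries $\pi_A$ onto $(A,L_A)$ and $\pi_B$ onto $(B,L_B)$; its *extent* $\chi(\tau)$ is the largest of the two Hausdorff distances, for $\mathsf{mk}_{L_E}$, between $\mathscr{S}(E)$ and $\{\varphi\circ\pi_A:\varphi\in\mathscr{S}(A)\}$, and between $\mathscr{S}(E)$ and $\{\varphi\circ\pi_B:\varphi\in\mathscr{S}(B)\}$. A class $\mathcal{T}$ of $F$-tunnels is *appropriate* for a class $\mathcal{C}$ of $F$-quasi-Leibniz quantum compact metric spaces if: (i) tunnels in $\mathcal{T}$ have domain and codomain in $\mathcal{C}$; (ii) any two elements of $\mathcal{C}$ are joined by a tunnel in $\mathcal{T}$; (iii) $(E,L_E,\pi,\rho)\in\mathcal{T}$ implies $(E,L_E,\rho,\pi)\in\mathcal{T}$; (iv) for every full quantum isometry $h:(A,L_A)\to(B,L_B)$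 between elements of $\mathcal{C}$, the tunnels $(A,L_A,\mathrm{id},h)$ and $(B,L_B,h^{-1},\mathrm{id})$ are in $\mathcal{T}$; (v) if $\tau,\gamma\in\mathcal{T}$ go from $(A,L_A)$ to $(B,L_B)$ and from $(B,L_B)$ to $(C,L_C)$, then for every $\varepsilon>0$ there is a tunnel in $\mathcal{T}$ from $(A,L_A)$ to $(C,L_C)$ of extent $<\chi(\tau)+\chi(\gamma)+\varepsilon$. The *dual $\mathcal{T}$-propinquity* $\Lambda^*_{\mathcal{T}}((A,L_A),(B,L_B))$ is the infimum of the extents of the tunnels in $\mathcal{T}$ from $(A,L_A)$ to $(B,L_B)$. The *Monge–Kantorovich length* of a *-automorphism $\varphi$ of $A$ is $\mathsf{mk}\ell_L(\varphi)=\sup\{\|\varphi(a)-a\|: a\in\mathrm{dom}(L),\,L(a)\le 1\}$. **Theorem.** Let $F$ be an admissible function which takes finite values on $[0,\infty)^4$, let $\mathcal{C}$ be a nonempty class of $F$-quasi-Leibniz quantum compact metric spaces, and let $\mathcal{T}$ be a class of tunnels appropriate for $\mathcal{C}$. Let $G$ be a group and $(G_n)_{n\in\mathbb{N}}$ an increasing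 sequence of subgroups of $G$ with $G=\bigcup_n G_n$. Assume that each $G_n$ is a separable first-countable topological group and that each inclusion $G_n\hookrightarrow G_{n+1}$ is continuous. Endow $G$ with the inductive limit topology: $U\subseteq G$ is open if and only if $U\cap G_n$ is open in $G_n$ for all $n$. Let $(A_n,L_n)_{n\in\mathbb{N}}$ be a sequence in $\mathcal{C}$ and, for each $n$, let $\alpha_n$ be an action of $G_n$ on $A_n$ by *-automorphisms. Let $D:G\to[0,\infty)$ be continuous, with $L_n(\alpha_n^g(a))\le D(g)L_n(a)$ for all $n$, $g\in G_n$ and $a\in\mathrm{dom}(L_n)$. Let $K:G\times G\to[0,\infty)$ be continuous, with $K(g,g)=0$ for all $g\in G$ and $$\|\alpha_n^h(a)-\alpha_n^g(a)\|_{A_n}\le L_n(a)K(h,g)\qquad\text{for all } n,\ g,h\in G_n,\ a\in\mathrm{dom}(L_n).$$ If $(A,L)\in\mathcal{C}$ satisfies $\lim_{n\to\infty}\Lambda^*_{\mathcal{T}}((A_n,L_n),(A,L))=0$, then there exists an action $\alpha$ of $G$ on $A$ by *-automorphisms which is strongly continuous (that is, $g\mapsto\alpha^g(a)$ is norm continuous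 on $G$ for every $a\in A$) and such that: 1. $L(\alpha^g(a))\le D(g)L(a)$ for all $g\in G$ and $a\in\mathrm{dom}(L)$; 2. $\|\alpha^g(a)-\alpha^h(a)\|_A\le L(a)K(g,h)$ for all $g,h\in G$ and $a\in\mathrm{dom}(L)$; 3. for all $g\in G$ and all $N\in\mathbb{N}$ with $g\in G_N$, $$\liminf_{n\to\infty,\ n\ge N}\mathsf{mk}\ell_{L_n}(\alpha_n^g)\le\mathsf{mk}\ell_L(\alpha^g)\le\limsup_{n\to\infty,\ n\ge N}\mathsf{mk}\ell_{L_n}(\alpha_n^g).$$ -/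

import Mathlib

open Filter Topology
open scoped ENNReal NNReal ComplexOrder

universe u
noncomputable section

/-- Admissible functions `F : [0,∞]⁴ → [0,∞]`: weakly increasing for the product order, and
`x l_y + y l_x ≤ F(x, y, l_x, l_y)`. -/
structure IsAdmissible (F : ℝ≥0∞ → ℝ≥0∞ → ℝ≥0∞ → ℝ≥0∞ → ℝ≥0∞) : Prop where
  mono : ∀ x x' y y' lx lx' ly ly' : ℝ≥0∞, x ≤ x' → y ≤ y' → lx ≤ lx' → ly ≤ ly' →
    F x y lx ly ≤ F x' y' lx' ly'
  leibniz_le : ∀ x y lx ly : ℝ≥0∞, x * ly + y * lx ≤ F x y lx ly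

/-- The state space of a unital C*-algebra (positive linear functionals of value `1` at `1`),
as a subspace of the dual with its weak* topology. -/
def StateSpace (A : Type*) [CStarAlgebra A] : Type _ :=
  {φ : WeakDual ℂ A // (∀ a : A, 0 ≤ φ (star a * a)) ∧ φ 1 = 1}

/-- The weak* topology. -/
instance (A : Type*) [CStarAlgebra A] : TopologicalSpace (StateSpace A) :=
  inferInstanceAs (TopologicalSpace {φ : WeakDual ℂ A // (∀ a : A, 0 ≤ φ (star a * a)) ∧ φ 1 = 1})

/-- The value `φ(a)` of a state. -/
def StateSpace.eval {A : Type*} [CStarAlgebra A] (φ : StateSpace A) (a : A) : ℂ := φ.1 a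

/-- The map `π^* : S(B) → S(A)`, `φ ↦ φ ∘ π`, for a unital *-homomorphism `π : A → B`. -/
def StateSpace.pullback {A B : Type*} [CStarAlgebra A] [CStarAlgebra B] (π : A →⋆ₐ[ℂ] B)
    (φ : StateSpace B) : StateSpace A :=
  ⟨((φ.1 : B →L[ℂ] ℂ).comp
      ({ toLinearMap := π.toAlgHom.toLinearMap
         cont := AddMonoidHomClass.continuous_of_bound π 1 fun a => by
          simpa using NonUnitalStarAlgHom.norm_apply_le π a } : A →L[ℂ] B) :
      A →L[ℂ] ℂ),
    fun a => by
      have h := φ.2.1 (π a)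
      rw [← map_star, ← map_mul] at h
      exact h,
    (congrArg φ.1 (map_one π)).trans φ.2.2⟩

/-- The Monge-Kantorovich metric between states associated with a function `L : A → [0,∞]`:
`sup {|φ(a) - ψ(a)| : L(a) ≤ 1}`. -/
def mongeKantorovich {A : Type*} [CStarAlgebra A] (L : A → ℝ≥0∞) (φ ψ : StateSpace A) : ℝ≥0∞ :=
  ⨆ (a : A) (_ : L a ≤ 1), ‖φ.eval a - ψ.eval a‖ₑ

/-- The Jordan product `(ab + ba)/2`. -/
def jordanProd {A : Type*} [CStarAlgebra A] (a b : A) : A := (1 / 2 : ℂ) • (a * b + b * a)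

/-- The Lie product `(ab - ba)/(2i)`. -/
def lieProd {A : Type*} [CStarAlgebra A] (a b : A) : A :=
  (1 / (2 * Complex.I) : ℂ) • (a * b - b * a)

/-- An `F`-quasi-Leibniz quantum compact metric space `(A, L)`. The seminorm `L` is given
together with its extension by `∞` outside of its domain: the domain is `{a | L a < ∞}`,
it consists of self-adjoint elements, and `L = ∞` elsewhere. The algebra is nonzero. -/
structure QQCMS (F : ℝ≥0∞ → ℝ≥0∞ → ℝ≥0∞ → ℝ≥0∞ → ℝ≥0∞) : Type (u + 1) where
  /-- The underlying unital C*-algebra. -/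
  carrier : Type u
  [cstar : CStarAlgebra carrier]
  [nontrivial : Nontrivial carrier]
  /-- The L-seminorm. -/
  L : carrier → ℝ≥0∞
  isSelfAdjoint_of_lt_top : ∀ a, L a < ⊤ → IsSelfAdjoint a
  L_add_le : ∀ a b, L (a + b) ≤ L a + L b
  L_smul : ∀ (r : ℝ) (a : carrier), L ((r : ℂ) • a) = ‖r‖ₑ * L a
  dense_dom : ∀ a, IsSelfAdjoint a → a ∈ closure {b | L b < ⊤}
  jordan_mem : ∀ a b, L a < ⊤ → L b < ⊤ → L (jordanProd a b) < ⊤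
  lie_mem : ∀ a b, L a < ⊤ → L b < ⊤ → L (lieProd a b) < ⊤
  L_eq_zero_iff : ∀ a, L a = 0 ↔ ∃ r : ℝ, a = (r : ℂ) • (1 : carrier)
  /-- `mk_L` is a metric (with finite values) inducing the weak* topology of the state space. -/
  mk_ne_top : ∀ φ ψ : StateSpace carrier, mongeKantorovich L φ ψ ≠ ⊤
  nhds_basis_mk : ∀ φ : StateSpace carrier,
    (𝓝 φ).HasBasis (fun ε : ℝ≥0∞ => 0 < ε) (fun ε => {ψ | mongeKantorovich L ψ φ < ε})
  leibniz : ∀ a b, L a < ⊤ → L b < ⊤ →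
    max (L (jordanProd a b)) (L (lieProd a b)) ≤ F ‖a‖ₑ ‖b‖ₑ (L a) (L b)
  lsc : LowerSemicontinuous L

namespace QQCMS

variable {F : ℝ≥0∞ → ℝ≥0∞ → ℝ≥0∞ → ℝ≥0∞ → ℝ≥0∞}

instance : CoeSort (QQCMS.{u} F) (Type u) := ⟨QQCMS.carrier⟩

instance (A : QQCMS.{u} F) : CStarAlgebra A := A.cstar

instance (A : QQCMS.{u} F) : Nontrivial A := A.nontrivial

/-- The metric space structure on the state space given by the Monge-Kantorovich metric, as an
extended metric. -/
@[reducible] def mkEMetric (A : QQCMS.{u} F) : PseudoEMetricSpace (StateSpace A) where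
  edist := mongeKantorovich A.L
  edist_self φ := by simp [mongeKantorovich]
  edist_comm φ ψ := iSup_congr fun _ => iSup_congr fun _ => by
    rw [← edist_eq_enorm_sub, ← edist_eq_enorm_sub, edist_comm]
  edist_triangle φ ψ χ := by
    refine iSup₂_le fun a ha => ?_
    have h1 : ‖φ.eval a - ψ.eval a‖ₑ ≤ mongeKantorovich A.L φ ψ :=
      le_iSup₂ (f := fun (a : A) (_ : A.L a ≤ 1) => ‖φ.eval a - ψ.eval a‖ₑ) a ha
    have h2 : ‖ψ.eval a - χ.eval a‖ₑ ≤ mongeKantorovich A.L ψ χ :=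
      le_iSup₂ (f := fun (a : A) (_ : A.L a ≤ 1) => ‖ψ.eval a - χ.eval a‖ₑ) a ha
    calc ‖φ.eval a - χ.eval a‖ₑ = ‖(φ.eval a - ψ.eval a) + (ψ.eval a - χ.eval a)‖ₑ := by
          congr 1; ring
      _ ≤ _ := (enorm_add_le _ _).trans (add_le_add h1 h2)

/-- Quantum isometries: *-epimorphisms such that `L_B` is the quotient of `L_A`. -/
structure IsQuantumIsometry (A B : QQCMS.{u} F) (π : A →⋆ₐ[ℂ] B) : Prop where
  surjective : Function.Surjective π
  L_eq : ∀ b : B, IsSelfAdjoint b → B.L b = ⨅ (a : A) (_ : π a = b), A.L a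

/-- Full quantum isometries: *-isomorphisms with `L_B ∘ h = L_A`. -/
def IsFullQuantumIsometry (A B : QQCMS.{u} F) (h : A ≃⋆ₐ[ℂ] B) : Prop :=
  ∀ a : A, B.L (h a) = A.L a

theorem IsFullQuantumIsometry.symm {A B : QQCMS.{u} F} {h : A ≃⋆ₐ[ℂ] B}
    (hh : IsFullQuantumIsometry A B h) : IsFullQuantumIsometry B A h.symm := by
  intro b
  rw [← hh, StarAlgEquiv.apply_symm_apply]

theorem IsFullQuantumIsometry.refl (A : QQCMS.{u} F) :
    IsFullQuantumIsometry A A (StarAlgEquiv.refl ℂ A) := fun _ => rfl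

theorem IsFullQuantumIsometry.isQuantumIsometry {A B : QQCMS.{u} F} {h : A ≃⋆ₐ[ℂ] B}
    (hh : IsFullQuantumIsometry A B h) : IsQuantumIsometry A B h.toStarAlgHom where
  surjective := h.surjective
  L_eq b _ := by
    refine le_antisymm (le_iInf₂ fun a ha => ?_) ?_
    · rw [← hh a, ← ha]
      exact le_rfl
    · refine (iInf₂_le (h.symm b) (h.apply_symm_apply b)).trans ?_
      rw [← hh, StarAlgEquiv.apply_symm_apply]

/-- An `F`-tunnel from `A` (its domain) to `B` (its codomain). -/
structure Tunnel (A B : QQCMS.{u} F) : Type (u + 1) where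
  /-- The `F`-quasi-Leibniz quantum compact metric space `(D, L_D)`. -/
  D : QQCMS.{u} F
  /-- The quantum isometry onto the domain. -/
  fst : D →⋆ₐ[ℂ] A
  /-- The quantum isometry onto the codomain. -/
  snd : D →⋆ₐ[ℂ] B
  fst_isometry : IsQuantumIsometry D A fst
  snd_isometry : IsQuantumIsometry D B snd

namespace Tunnel

/-- The inverse tunnel `(D, L_D, π_B, π_A)`. -/
def inv {A B : QQCMS.{u} F} (τ : Tunnel A B) : Tunnel B A :=
  ⟨τ.D, τ.snd, τ.fst, τ.snd_isometry, τ.fst_isometry⟩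

/-- The tunnel `(A, L_A, id, h)` from `A` to `B` given by a full quantum isometry `h`. -/
def idLeft {A B : QQCMS.{u} F} (h : A ≃⋆ₐ[ℂ] B) (hh : IsFullQuantumIsometry A B h) :
    Tunnel A B :=
  ⟨A, (StarAlgEquiv.refl ℂ A).toStarAlgHom, h.toStarAlgHom,
    (IsFullQuantumIsometry.refl A).isQuantumIsometry, hh.isQuantumIsometry⟩

/-- The tunnel `(B, L_B, h⁻¹, id)` from `A` to `B` given by a full quantum isometry `h`. -/
def idRight {A B : QQCMS.{u} F} (h : A ≃⋆ₐ[ℂ] B) (hh : IsFullQuantumIsometry A B h) :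
    Tunnel A B :=
  ⟨B, h.symm.toStarAlgHom, (StarAlgEquiv.refl ℂ B).toStarAlgHom,
    hh.symm.isQuantumIsometry, (IsFullQuantumIsometry.refl B).isQuantumIsometry⟩

/-- The extent of a tunnel: the largest of the two Hausdorff distances, for the Monge-Kantorovich
metric of `L_D`, between `S(D)` and the images of `S(A)` and `S(B)`. -/
def extent {A B : QQCMS.{u} F} (τ : Tunnel A B) : ℝ≥0∞ :=
  max
    (@Metric.hausdorffEDist _ τ.D.mkEMetric Set.univ
      (Set.range (StateSpace.pullback τ.fst : StateSpace A → StateSpace τ.D)))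
    (@Metric.hausdorffEDist _ τ.D.mkEMetric Set.univ
      (Set.range (StateSpace.pullback τ.snd : StateSpace B → StateSpace τ.D)))

end Tunnel

/-- A class `𝒯` of `F`-tunnels is appropriate for a class `𝒞` of `F`-quasi-Leibniz quantum compact
metric spaces. -/
structure IsAppropriate (𝒞 : Set (QQCMS.{u} F)) (𝒯 : ∀ A B : QQCMS.{u} F, Set (Tunnel A B)) :
    Prop where
  dom_codom_mem : ∀ (A B : QQCMS.{u} F) (τ : Tunnel A B), τ ∈ 𝒯 A B → A ∈ 𝒞 ∧ B ∈ 𝒞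
  exists_tunnel : ∀ A ∈ 𝒞, ∀ B ∈ 𝒞, ∃ τ : Tunnel A B, τ ∈ 𝒯 A B
  inv_mem : ∀ (A B : QQCMS.{u} F) (τ : Tunnel A B), τ ∈ 𝒯 A B → τ.inv ∈ 𝒯 B A
  isometry_mem : ∀ A ∈ 𝒞, ∀ B ∈ 𝒞, ∀ (h : A ≃⋆ₐ[ℂ] B) (hh : IsFullQuantumIsometry A B h),
    Tunnel.idLeft h hh ∈ 𝒯 A B ∧ Tunnel.idRight h hh ∈ 𝒯 A B
  comp_mem : ∀ (A B C : QQCMS.{u} F) (τ : Tunnel A B) (γ : Tunnel B C),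
    τ ∈ 𝒯 A B → γ ∈ 𝒯 B C → ∀ ε : ℝ≥0∞, 0 < ε →
      ∃ σ : Tunnel A C, σ ∈ 𝒯 A C ∧ σ.extent < τ.extent + γ.extent + ε

/-- The dual `𝒯`-propinquity. -/
def propinquity (𝒯 : ∀ A B : QQCMS.{u} F, Set (Tunnel A B)) (A B : QQCMS.{u} F) : ℝ≥0∞ :=
  ⨅ (τ : Tunnel A B) (_ : τ ∈ 𝒯 A B), τ.extent

/-- The Monge-Kantorovich distance between linear maps from `(A, L)` to `B`:
`sup {‖φ(a) - ψ(a)‖ : L(a) ≤ 1}`. -/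
def mkDist (A : QQCMS.{u} F) {B : Type*} [CStarAlgebra B] (φ ψ : A →ₗ[ℂ] B) : ℝ≥0∞ :=
  ⨆ (a : A) (_ : A.L a ≤ 1), ‖φ a - ψ a‖ₑ

/-- The Monge-Kantorovich length of a *-automorphism: its distance to the identity. -/
def mkLength (A : QQCMS.{u} F) (φ : A ≃⋆ₐ[ℂ] A) : ℝ≥0∞ :=
  A.mkDist LinearMap.id φ.toAlgEquiv.toLinearMap

end QQCMS

/-- The inductive limit topology on the union `G` of subgroups `Gs n` carrying topologies `t n`:
the largest topology for which all the inclusions `Gs n → G` are continuous. -/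
@[reducible] def inductiveLimitTopology {G : Type*} [Group G] (Gs : ℕ → Subgroup G)
    (t : ∀ n, TopologicalSpace (Gs n)) : TopologicalSpace G :=
  ⨆ n, (t n).coinduced (Subtype.val : Gs n → G)

end

/-! A tunnel of small extent makes its two ends nearly indistinguishable on Lipschitz elements.
Every state of the tunnel algebra is close to a state pulled back from either end, and states norm
self-adjoint elements. So if `L d ≤ l`, the norms of `d` and of its two images differ by at most `l
* m`, for any `m` above the extent.

Choose tunnels with extents tending to zero and fix an ultrafilter `U` finer than `atTop`. `Tracks`
joins a sequence `a n` to an element `b` through lifts of bounded Lipschitz seminorm, up to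
arbitrarily small errors. It behaves as convergence of `a n` to `b`: the limit is unique
(`Tracks.unique`), sums and adjoints pass to the limit, and so do products, by the Leibniz
inequality with `F` finite (`Tracks.mul`). Every `b` is a limit (`Tracks.exists_left`). A sequence
bounded in norm and in Lipschitz seminorm has a limit (`Tracks.exists_right_of_L_le`), because the
corresponding balls of `B` are compact (`isCompact_L_le_inter_norm_le`).

The bound by `D g` keeps images of sequences with a limit in that class, so the automorphisms have a
limit morphism (`exists_limit_hom`); since `U` is the same for all `g`, uniqueness of limits yields
an action. Bounds on seminorms and norms survive the limit (`Tracks.L_le`,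
`Tracks.norm_le_of_L_le`), which gives both estimates, and the one by `K` gives strong continuity.
Lengths are compared by moving test elements from `B` to `A n` for the upper bound, and from `A n`
to `B` for the lower one. -/

namespace StateSpace

/-! ### States of a C*-algebra: compactness and norming of self-adjoint elements. -/

variable {A : Type*} [CStarAlgebra A]

theorem eval_add (φ : StateSpace A) (a b : A) : φ.eval (a + b) = φ.eval a + φ.eval b :=
  map_add φ.1 a b

theorem eval_sub (φ : StateSpace A) (a b : A) : φ.eval (a - b) = φ.eval a - φ.eval b :=
  map_sub φ.1 a b

theorem eval_smul (φ : StateSpace A) (c : ℂ) (a : A) : φ.eval (c • a) = c * φ.eval a :=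
  map_smul φ.1 c a

theorem eval_one (φ : StateSpace A) : φ.eval 1 = 1 := φ.2.2

theorem eval_pullback {B : Type*} [CStarAlgebra B] (π : A →⋆ₐ[ℂ] B) (φ : StateSpace B) (a : A) :
    (pullback π φ).eval a = φ.eval (π a) := rfl

/-- For `a` self-adjoint, `‖a‖ - a` is a square. -/
theorem exists_star_mul_self_eq {a : A} (ha : IsSelfAdjoint a) :
    ∃ c : A, star c * c = ((‖a‖ : ℝ) : ℂ) • (1 : A) - a := by
  let _ := CStarAlgebra.spectralOrder A
  have := CStarAlgebra.spectralOrderedRing A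
  have h := ha.le_algebraMap_norm_self
  rw [← sub_nonneg, CStarAlgebra.nonneg_iff_eq_star_mul_self] at h
  obtain ⟨c, hc⟩ := h
  refine ⟨c, hc.symm.trans ?_⟩
  rw [Algebra.algebraMap_eq_smul_one, Complex.coe_smul]

theorem eval_le_norm (φ : StateSpace A) {a : A} (ha : IsSelfAdjoint a) :
    φ.eval a ≤ ((‖a‖ : ℝ) : ℂ) := by
  obtain ⟨c, hc⟩ := exists_star_mul_self_eq ha
  have h : 0 ≤ φ.eval (star c * c) := φ.2.1 c
  rw [hc, eval_sub, eval_smul, eval_one, mul_one] at h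
  exact sub_nonneg.1 h

theorem eval_eq_re (φ : StateSpace A) {a : A} (ha : IsSelfAdjoint a) :
    φ.eval a = ((φ.eval a).re : ℂ) := by
  have h := (Complex.le_def.1 (φ.eval_le_norm ha)).2
  refine Complex.ext (by simp) ?_
  simpa using h

theorem norm_eval_le (φ : StateSpace A) {a : A} (ha : IsSelfAdjoint a) : ‖φ.eval a‖ ≤ ‖a‖ := by
  have h1 := (Complex.le_def.1 (φ.eval_le_norm ha)).1
  have h2 := (Complex.le_def.1 (φ.eval_le_norm ha.neg)).1
  have h3 : φ.eval (-a) = -φ.eval a := map_neg φ.1 a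
  rw [h3, norm_neg] at h2
  rw [eval_eq_re φ ha, Complex.norm_real, Real.norm_eq_abs, abs_le]
  simp only [Complex.neg_re, Complex.ofReal_re] at h1 h2
  exact ⟨by linarith, h1⟩

theorem norm_eval_le_two_mul (φ : StateSpace A) (a : A) : ‖φ.eval a‖ ≤ 2 * ‖a‖ := by
  have h := realPart_add_I_smul_imaginaryPart a
  calc ‖φ.eval a‖ = ‖φ.eval (realPart a : A) + Complex.I * φ.eval (imaginaryPart a : A)‖ := by
        rw [← eval_smul, ← eval_add, h]
    _ ≤ ‖φ.eval (realPart a : A)‖ + ‖φ.eval (imaginaryPart a : A)‖ := by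
        refine (norm_add_le _ _).trans_eq ?_
        simp
    _ ≤ ‖a‖ + ‖a‖ := add_le_add
        ((φ.norm_eval_le (realPart a).2).trans (realPart.norm_le a))
        ((φ.norm_eval_le (imaginaryPart a).2).trans (imaginaryPart.norm_le a))
    _ = 2 * ‖a‖ := by ring

/-- Banach–Alaoglu needs only some norm bound, so the crude constant 2 coming from real and
imaginary parts suffices. -/
instance compactSpace : CompactSpace (StateSpace A) := by
  suffices h : IsCompact {φ : WeakDual ℂ A | (∀ a : A, 0 ≤ φ (star a * a)) ∧ φ 1 = 1} from
    isCompact_iff_compactSpace.1 h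
  refine WeakDual.isCompact_of_bounded_of_closed ?_ ?_
  · refine (Metric.isBounded_closedBall (x := (0 : StrongDual ℂ A)) (r := 2)).subset ?_
    intro φ hφ
    rw [mem_closedBall_zero_iff]
    exact ContinuousLinearMap.opNorm_le_bound _ (by norm_num)
      fun a => norm_eval_le_two_mul ⟨_, hφ⟩ a
  · rw [Set.ofPred_and, Set.ofPred_forall]
    refine (isClosed_iInter fun a => ?_).inter ?_
    · exact isClosed_le continuous_const (WeakDual.eval_continuous _)
    · exact isClosed_eq (WeakDual.eval_continuous _) continuous_const

/-- A functional of norm at most `1` with value `1` at `1` is real on self-adjoint elements. -/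
theorem im_eq_zero_of_opNorm_le_one {f : StrongDual ℂ A} (hf : ‖f‖ ≤ 1) (h1 : f 1 = 1) {a : A}
    (ha : IsSelfAdjoint a) : (f a).im = 0 := by
  by_contra hne
  -- Adding `i t` to `a` shifts the imaginary part of `f a` linearly in `t`, while the C*-identity
  -- lets the squared norm grow only by `t ^ 2`.
  have key : ∀ t : ℝ, ((f a).im + t) ^ 2 ≤ ‖a‖ ^ 2 + t ^ 2 := by
    intro t
    have e1 : f (a + (t * Complex.I : ℂ) • 1) = f a + t * Complex.I := by
      rw [map_add, map_smul, h1, smul_eq_mul, mul_one]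
    have e2 : ‖a + (t * Complex.I : ℂ) • (1 : A)‖ ^ 2 ≤ ‖a‖ ^ 2 + t ^ 2 := by
      rw [sq, ← CStarRing.norm_star_mul_self]
      have : star (a + (t * Complex.I : ℂ) • (1 : A)) * (a + (t * Complex.I : ℂ) • (1 : A))
          = a * a + ((t ^ 2 : ℝ) : ℂ) • (1 : A) := by
        rw [star_add, star_smul, ha.star_eq, star_one]
        have h2 : star ((t : ℂ) * Complex.I) = -(t * Complex.I) := by simp
        have h3 : ((t ^ 2 : ℝ) : ℂ) = -(t * Complex.I) * (t * Complex.I) := by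
          push_cast
          linear_combination ((t : ℂ) ^ 2) * Complex.I_sq
        rw [h2, h3]
        simp only [add_mul, mul_add, smul_mul_assoc, mul_smul_comm, one_mul, mul_one]
        module
      rw [this]
      refine (norm_add_le _ _).trans (add_le_add ((norm_mul_le _ _).trans_eq (sq _).symm) ?_)
      refine (norm_smul_le _ _).trans ?_
      rw [Complex.norm_real, Real.norm_of_nonneg (sq_nonneg t)]
      refine mul_le_of_le_one_right (sq_nonneg t) ?_
      rcases subsingleton_or_nontrivial A with h | h
      · rw [Subsingleton.elim (1 : A) 0]; simp
      · simp
    have e3 : ‖f a + t * Complex.I‖ ≤ ‖a + (t * Complex.I : ℂ) • (1 : A)‖ := by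
      rw [← e1]
      exact (f.le_of_opNorm_le hf _).trans_eq (one_mul _)
    have e4 : |(f a).im + t| ≤ ‖f a + t * Complex.I‖ := by
      have := Complex.abs_im_le_norm (f a + t * Complex.I)
      simpa using this
    calc ((f a).im + t) ^ 2 = |(f a).im + t| ^ 2 := (sq_abs _).symm
      _ ≤ ‖a + (t * Complex.I : ℂ) • (1 : A)‖ ^ 2 := by gcongr; exact e4.trans e3
      _ ≤ _ := e2
  -- For this `t` the cross term `2 * (f a).im * t` equals `‖a‖ ^ 2 + 1`, which breaks the
  -- inequality.
  have := key ((‖a‖ ^ 2 + 1) / (2 * (f a).im))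
  have h2 : 2 * (f a).im * ((‖a‖ ^ 2 + 1) / (2 * (f a).im)) = ‖a‖ ^ 2 + 1 := by
    field_simp
  nlinarith [sq_nonneg (f a).im]

/-- A functional of norm at most `1` with value `1` at `1` is a state. -/
noncomputable def ofNormLeOne (f : StrongDual ℂ A) (hf : ‖f‖ ≤ 1) (h1 : f 1 = 1) : StateSpace A := by
  refine ⟨f, fun a => ?_, h1⟩
  have hs : IsSelfAdjoint (star a * a) := IsSelfAdjoint.star_mul_self a
  change 0 ≤ f (star a * a)
  rw [Complex.le_def]
  refine ⟨?_, (im_eq_zero_of_opNorm_le_one hf h1 hs).symm⟩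
  set b := star a * a
  -- As `0 ≤ b ≤ ‖b‖`, applying `f` puts `f b` in the disc of centre and radius `‖b‖`, hence in the
  -- right half-plane.
  have hn : ‖((‖b‖ : ℝ) : ℂ) • (1 : A) - b‖ ≤ ‖b‖ := by
    let _ := CStarAlgebra.spectralOrder A
    have := CStarAlgebra.spectralOrderedRing A
    have hb0 : 0 ≤ b := star_mul_self_nonneg a
    have hle := hs.le_algebraMap_norm_self
    have e : ((‖b‖ : ℝ) : ℂ) • (1 : A) = algebraMap ℝ A ‖b‖ := by
      rw [Algebra.algebraMap_eq_smul_one, Complex.coe_smul]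
    rw [e]
    exact (CStarAlgebra.norm_le_iff_le_algebraMap _ (norm_nonneg b) (sub_nonneg.2 hle)).2
      (sub_le_self _ hb0)
  have h2 : ‖((‖b‖ : ℝ) : ℂ) - f b‖ ≤ ‖b‖ := by
    have := (f.le_of_opNorm_le hf (((‖b‖ : ℝ) : ℂ) • (1 : A) - b)).trans ((one_mul _).trans_le hn)
    rwa [map_sub, map_smul, h1, smul_eq_mul, mul_one] at this
  have h3 := (Complex.re_le_norm _).trans h2
  simp only [Complex.sub_re, Complex.ofReal_re] at h3
  simp only [Complex.zero_re]
  linarith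

/-- Every self-adjoint element is normed by a state. -/
theorem exists_norm_eval_eq [Nontrivial A] {a : A} (ha : IsSelfAdjoint a) :
    ∃ φ : StateSpace A, ‖φ.eval a‖ = ‖a‖ := by
  have : IsStarNormal a := ha.isStarNormal
  let S := StarAlgebra.elemental ℂ a
  let x : S := ⟨a, StarAlgebra.elemental.self_mem ℂ a⟩
  have hx : IsSelfAdjoint x := Subtype.ext ha.star_eq
  -- In the commutative algebra generated by `a` the norm is attained by a character; its
  -- norm-preserving Hahn–Banach extension is a state.
  obtain ⟨z, hz, hzn⟩ := spectrum.exists_nnnorm_eq_spectralRadius x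
  rw [hx.spectralRadius_eq_nnnorm] at hzn
  obtain ⟨χ, hχ⟩ := WeakDual.CharacterSpace.mem_spectrum_iff_exists.1 hz
  have hχ1 : ‖WeakDual.toStrongDual (χ : WeakDual ℂ S)‖ ≤ 1 := by
    have := WeakDual.CharacterSpace.norm_le_norm_one χ
    simpa using this
  obtain ⟨f, hf, hfn⟩ := exists_extension_norm_eq (𝕜 := ℂ) (E := A)
    (Subalgebra.toSubmodule S.toSubalgebra) (WeakDual.toStrongDual (χ : WeakDual ℂ S))
  refine ⟨ofNormLeOne f (hfn.trans_le hχ1) ?_, ?_⟩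
  · exact (hf (1 : S)).trans (map_one χ)
  · have h1 : f a = z := (hf x).trans hχ
    change ‖f a‖ = _
    rw [h1]
    have h2 : ‖z‖₊ = ‖x‖₊ := by exact_mod_cast hzn
    exact congrArg NNReal.toReal h2

theorem norm_le_of_forall_eval [Nontrivial A] {a : A} (ha : IsSelfAdjoint a) {M : ℝ}
    (h : ∀ φ : StateSpace A, ‖φ.eval a‖ ≤ M) : ‖a‖ ≤ M := by
  obtain ⟨φ, hφ⟩ := exists_norm_eval_eq ha
  exact hφ ▸ h φ

end StateSpace

/-! ### Lipschitz estimates on states and compactness of Lipschitz balls. -/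

namespace QQCMS

variable {F : ℝ≥0∞ → ℝ≥0∞ → ℝ≥0∞ → ℝ≥0∞ → ℝ≥0∞} (X : QQCMS.{u} F)

theorem isSelfAdjoint_of_le {l : ℝ≥0} {a : X} (h : X.L a ≤ l) : IsSelfAdjoint a :=
  X.isSelfAdjoint_of_lt_top a (h.trans_lt ENNReal.coe_lt_top)

theorem L_real_smul_one (r : ℝ) : X.L ((r : ℂ) • (1 : X)) = 0 := (X.L_eq_zero_iff _).2 ⟨r, rfl⟩

theorem L_zero : X.L 0 = 0 := (X.L_eq_zero_iff _).2 ⟨0, by simp⟩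

theorem L_neg (a : X) : X.L (-a) = X.L a := by
  have := X.L_smul (-1) a
  simpa using this

theorem L_sub_le (a b : X) : X.L (a - b) ≤ X.L a + X.L b := by
  rw [sub_eq_add_neg, ← X.L_neg b]
  exact X.L_add_le _ _

/-- Homogeneity reduces to `L a = 1`; when `L a = 0` the element is scalar and all states agree on
it. -/
theorem enorm_eval_sub_le {a : X} (ha : X.L a < ⊤) (φ ψ : StateSpace X) :
    ‖φ.eval a - ψ.eval a‖ₑ ≤ X.L a * mongeKantorovich X.L φ ψ := by
  rcases eq_or_ne (X.L a) 0 with h0 | h0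
  · obtain ⟨r, rfl⟩ := (X.L_eq_zero_iff a).1 h0
    rw [φ.eval_smul, ψ.eval_smul, φ.eval_one, ψ.eval_one]
    simp
  · have hl : 0 < (X.L a).toReal := ENNReal.toReal_pos h0 ha.ne
    have hinv : ‖(X.L a).toReal⁻¹‖ₑ = (X.L a)⁻¹ := by
      rw [Real.enorm_eq_ofReal (inv_nonneg.2 hl.le), ENNReal.ofReal_inv_of_pos hl,
        ENNReal.ofReal_toReal ha.ne]
    have h1 : X.L ((((X.L a).toReal⁻¹ : ℝ) : ℂ) • a) ≤ 1 := by
      rw [X.L_smul, hinv, ENNReal.inv_mul_cancel h0 ha.ne]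
    have h2 := le_iSup₂ (f := fun (a : X) (_ : X.L a ≤ 1) => ‖φ.eval a - ψ.eval a‖ₑ) _ h1
    simp only [StateSpace.eval_smul] at h2
    rw [← mul_sub, enorm_mul] at h2
    have h3 : ‖(((X.L a).toReal⁻¹ : ℝ) : ℂ)‖ₑ = (X.L a)⁻¹ := by
      rw [← hinv, ← ofReal_norm, ← ofReal_norm, Complex.norm_real]
    rw [h3] at h2
    calc ‖φ.eval a - ψ.eval a‖ₑ = X.L a * ((X.L a)⁻¹ * ‖φ.eval a - ψ.eval a‖ₑ) := by
          rw [← mul_assoc, ENNReal.mul_inv_cancel h0 ha.ne, one_mul]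
      _ ≤ _ := by gcongr; exact h2

theorem norm_eval_sub_le {a : X} {l m : ℝ≥0} (ha : X.L a ≤ l) {φ ψ : StateSpace X}
    (h : mongeKantorovich X.L φ ψ ≤ m) : ‖φ.eval a - ψ.eval a‖ ≤ l * m := by
  have h1 := (X.enorm_eval_sub_le (ha.trans_lt ENNReal.coe_lt_top) φ ψ).trans (mul_le_mul' ha h)
  have h2 : ‖φ.eval a - ψ.eval a‖₊ ≤ l * m := by
    rw [← ENNReal.coe_le_coe]
    exact_mod_cast h1
  exact_mod_cast h2

/-- If `S(X)` is within `m` of the image of `S(Y)`, then `π : X → Y` almost preserves the norm of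
elements with controlled Lipschitz seminorm. -/
theorem norm_le_of_hausdorffEDist_lt {Y : QQCMS.{u} F} (π : X →⋆ₐ[ℂ] Y) {m : ℝ≥0}
    (h : @Metric.hausdorffEDist _ X.mkEMetric Set.univ
      (Set.range (StateSpace.pullback π : StateSpace Y → StateSpace X)) < m)
    {d : X} {l : ℝ≥0} (hd : X.L d ≤ l) : ‖d‖ ≤ ‖π d‖ + l * m := by
  have hs := X.isSelfAdjoint_of_le hd
  refine StateSpace.norm_le_of_forall_eval hs fun φ => ?_
  obtain ⟨_, ⟨ψ, rfl⟩, hψ⟩ := @Metric.exists_edist_lt_of_hausdorffEDist_lt _ X.mkEMetric φ _ _ _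
    (Set.mem_univ φ) h
  have h1 := X.norm_eval_sub_le hd (show mongeKantorovich X.L φ (StateSpace.pullback π ψ) ≤ m
    from hψ.le)
  rw [StateSpace.eval_pullback] at h1
  have h2 := ψ.norm_eval_le (hs.map π)
  have h3 := norm_sub_norm_le (φ.eval d) (ψ.eval (π d))
  linarith

/-- The state space is covered by finitely many Monge-Kantorovich balls. -/
theorem exists_finite_net {ε : ℝ≥0} (hε : 0 < ε) :
    ∃ s : Finset (StateSpace X), ∀ φ, ∃ ψ ∈ s, mongeKantorovich X.L φ ψ < ε := by
  obtain ⟨s, -, hs⟩ := (isCompact_univ (X := StateSpace X)).elim_nhds_subcover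
    (fun ψ => {φ | mongeKantorovich X.L φ ψ < ε}) fun ψ _ => 
      (X.nhds_basis_mk ψ).mem_of_mem (ENNReal.coe_pos.2 hε)
  refine ⟨s, fun φ => ?_⟩
  simpa using hs (Set.mem_univ φ)

/-- Elements of bounded Lipschitz seminorm are at bounded distance from the scalars. -/
theorem exists_norm_sub_smul_one_le :
    ∃ M : ℝ≥0, ∀ (l : ℝ≥0) (a : X), X.L a ≤ l → ∃ r : ℝ, ‖a - (r : ℂ) • (1 : X)‖ ≤ l * M := by
  -- Only the existence of a state is used here; its value at `a` will be the scalar subtracted from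
  -- `a`.
  obtain ⟨φ₀, -⟩ := StateSpace.exists_norm_eval_eq (IsSelfAdjoint.one (R := X))
  obtain ⟨s, hs⟩ := X.exists_finite_net one_pos
  obtain ⟨m, hm⟩ : ∃ m : ℝ≥0, ∀ ψ ∈ s, mongeKantorovich X.L ψ φ₀ ≤ m := by
    refine ⟨∑ ψ ∈ s, (mongeKantorovich X.L ψ φ₀).toNNReal, fun ψ hψ => ?_⟩
    rw [← ENNReal.coe_toNNReal (X.mk_ne_top ψ φ₀), ENNReal.coe_le_coe]
    exact Finset.single_le_sum
      (f := fun ψ => (mongeKantorovich X.L ψ φ₀).toNNReal) (fun _ _ => zero_le) hψ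
  refine ⟨1 + m, fun l a ha => ⟨(φ₀.eval a).re, ?_⟩⟩
  have hsa := X.isSelfAdjoint_of_le ha
  have hr : IsSelfAdjoint ((((φ₀.eval a).re : ℝ) : ℂ) • (1 : X)) :=
    IsSelfAdjoint.smul (Complex.conj_ofReal _) (IsSelfAdjoint.one X)
  refine StateSpace.norm_le_of_forall_eval (hsa.sub hr) fun φ => ?_
  rw [StateSpace.eval_sub, StateSpace.eval_smul, StateSpace.eval_one, mul_one,
    ← φ₀.eval_eq_re hsa]
  obtain ⟨ψ, hψ, hφψ⟩ := hs φ
  refine X.norm_eval_sub_le ha ?_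
  push_cast
  exact (X.mkEMetric.edist_triangle φ ψ φ₀).trans (add_le_add hφψ.le (hm ψ hψ))

/-- Balls for the sum of the norm and the Lipschitz seminorm are compact. -/
theorem isCompact_L_le_inter_norm_le (l : ℝ≥0) (M : ℝ) :
    IsCompact {a : X | X.L a ≤ l ∧ ‖a‖ ≤ M} := by
  refine isCompact_iff_totallyBounded_isComplete.2 ⟨?_, IsClosed.isComplete ?_⟩
  -- Along an ultrafilter the values at each state converge. A finite net of states controls all the
  -- others because elements of the ball are `l`-Lipschitz on states, so the ultrafilter is norm
  -- Cauchy.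
  · refine totallyBounded_iff_ultrafilter.2 fun W hW => Metric.cauchy_iff.2 ⟨W.neBot, fun ε hε => ?_⟩
    obtain ⟨δ, hδ, hδε⟩ : ∃ δ : ℝ≥0, 0 < δ ∧ 4 * (l * δ) + 2 * δ < ε := by
      refine ⟨Real.toNNReal (ε / (2 * (4 * l + 2))), by positivity, ?_⟩
      rw [Real.coe_toNNReal _ (by positivity)]
      have : 4 * (l * (ε / (2 * (4 * l + 2)))) + 2 * (ε / (2 * (4 * l + 2))) = ε / 2 := by
        field_simp
      linarith
    obtain ⟨s, hs⟩ := X.exists_finite_net hδ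
    have hmem : {a : X | X.L a ≤ l ∧ ‖a‖ ≤ M} ∈ W := le_principal_iff.1 hW
    have hlim : ∀ ψ : StateSpace X, ∃ c : ℂ, Tendsto ψ.eval W (𝓝 c) := by
      intro ψ
      obtain ⟨c, -, hc⟩ := (isCompact_closedBall (0 : ℂ) M).ultrafilter_le_nhds (W.map ψ.eval) (by
        rw [Ultrafilter.coe_map, le_principal_iff]
        refine Filter.mem_map.2 (mem_of_superset hmem fun a ha => ?_)
        rw [Set.mem_preimage, mem_closedBall_zero_iff]
        exact (ψ.norm_eval_le (X.isSelfAdjoint_of_le ha.1)).trans ha.2)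
      exact ⟨c, hc⟩
    choose c hc using hlim
    have hev : ∀ᶠ a in W, ∀ ψ ∈ s, dist (ψ.eval a) (c ψ) < δ :=
      (Finset.eventually_all s).2 fun ψ _ => (hc ψ).eventually (Metric.ball_mem_nhds _ hδ)
    refine ⟨_, inter_mem hmem hev, fun a ha b hb => ?_⟩
    rw [dist_eq_norm]
    refine lt_of_le_of_lt (StateSpace.norm_le_of_forall_eval
      ((X.isSelfAdjoint_of_le ha.1.1).sub (X.isSelfAdjoint_of_le hb.1.1)) fun φ => ?_) hδε
    obtain ⟨ψ, hψ, hφψ⟩ := hs φ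
    have h1 := X.norm_eval_sub_le ha.1.1 hφψ.le
    have h2 := X.norm_eval_sub_le hb.1.1 hφψ.le
    have h3 := ha.2 ψ hψ
    have h4 := hb.2 ψ hψ
    rw [dist_eq_norm] at h3 h4
    rw [StateSpace.eval_sub]
    calc ‖φ.eval a - φ.eval b‖
        = ‖((φ.eval a - ψ.eval a) - (φ.eval b - ψ.eval b))
            + ((ψ.eval a - c ψ) - (ψ.eval b - c ψ))‖ := by congr 1; ring
      _ ≤ (l * δ + l * δ) + (δ + δ) :=
          (norm_add_le _ _).trans (add_le_add ((norm_sub_le _ _).trans (add_le_add h1 h2))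
            ((norm_sub_le _ _).trans (add_le_add h3.le h4.le)))
      _ ≤ _ := by nlinarith [mul_nonneg l.2 δ.2]
  · exact (X.lsc.isClosed_preimage _).inter (isClosed_le continuous_norm continuous_const)

end QQCMS

/-! ### Lifting along quantum isometries, and elements with Lipschitz real and imaginary parts. -/

namespace QQCMS

variable {F : ℝ≥0∞ → ℝ≥0∞ → ℝ≥0∞ → ℝ≥0∞ → ℝ≥0∞}

theorem IsQuantumIsometry.L_apply_le {X Y : QQCMS.{u} F} {π : X →⋆ₐ[ℂ] Y}
    (h : IsQuantumIsometry X Y π) (d : X) : Y.L (π d) ≤ X.L d := by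
  rcases eq_or_ne (X.L d) ⊤ with hd | hd
  · exact hd ▸ le_top
  · rw [h.L_eq _ ((X.isSelfAdjoint_of_lt_top d hd.lt_top).map π)]
    exact iInf₂_le (f := fun (a : X) (_ : π a = π d) => X.L a) d rfl

/-- The quotient seminorm is an infimum, so a lift is obtained at the price of a strict inequality.
-/
theorem IsQuantumIsometry.exists_lift {X Y : QQCMS.{u} F} {π : X →⋆ₐ[ℂ] Y}
    (h : IsQuantumIsometry X Y π) {b : Y} {l : ℝ≥0∞} (hb : Y.L b < l) :
    ∃ d, π d = b ∧ X.L d ≤ l := by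
  rw [h.L_eq _ (Y.isSelfAdjoint_of_lt_top b (hb.trans_le le_top))] at hb
  simp only [iInf_lt_iff] at hb
  obtain ⟨d, hd, hl⟩ := hb
  exact ⟨d, hd, hl.le⟩

/-- The real and imaginary parts of `a` have Lipschitz seminorm at most `l`. -/
def Reg (X : QQCMS.{u} F) (l : ℝ≥0) (a : X) : Prop :=
  ∃ x y : X, X.L x ≤ l ∧ X.L y ≤ l ∧ a = x + Complex.I • y

namespace Reg

variable {X Y : QQCMS.{u} F}

theorem of_L_le {l : ℝ≥0} {a : X} (h : X.L a ≤ l) : X.Reg l a :=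
  ⟨a, 0, h, X.L_zero ▸ zero_le, by simp⟩

theorem mono {l l' : ℝ≥0} {a : X} (h : X.Reg l a) (hl : l ≤ l') : X.Reg l' a := by
  obtain ⟨x, y, hx, hy, rfl⟩ := h
  have : (l : ℝ≥0∞) ≤ l' := ENNReal.coe_le_coe.2 hl
  exact ⟨x, y, hx.trans this, hy.trans this, rfl⟩

theorem add {l l' : ℝ≥0} {a b : X} (ha : X.Reg l a) (hb : X.Reg l' b) : X.Reg (l + l') (a + b) := by
  obtain ⟨x, y, hx, hy, rfl⟩ := ha
  obtain ⟨x', y', hx', hy', rfl⟩ := hb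
  refine ⟨x + x', y + y', ?_, ?_, by module⟩ <;> rw [ENNReal.coe_add]
  · exact (X.L_add_le _ _).trans (add_le_add hx hx')
  · exact (X.L_add_le _ _).trans (add_le_add hy hy')

theorem real_smul {l : ℝ≥0} {a : X} (ha : X.Reg l a) (r : ℝ) : X.Reg (‖r‖₊ * l) ((r : ℂ) • a) := by
  obtain ⟨x, y, hx, hy, rfl⟩ := ha
  refine ⟨(r : ℂ) • x, (r : ℂ) • y, ?_, ?_, by module⟩ <;>
    rw [X.L_smul, ENNReal.coe_mul] <;> exact mul_le_mul' le_rfl ‹_›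

theorem I_smul {l : ℝ≥0} {a : X} (ha : X.Reg l a) : X.Reg l (Complex.I • a) := by
  obtain ⟨x, y, hx, hy, rfl⟩ := ha
  refine ⟨-y, x, (X.L_neg y).trans_le hy, hx, ?_⟩
  rw [smul_add, smul_smul, Complex.I_mul_I]
  module

theorem smul {l : ℝ≥0} {a : X} (ha : X.Reg l a) (c : ℂ) :
    X.Reg (‖c.re‖₊ * l + ‖c.im‖₊ * l) (c • a) := by
  have h := (ha.real_smul c.re).add (ha.I_smul.real_smul c.im)
  rwa [smul_smul, ← add_smul, Complex.re_add_im] at h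

theorem sub {l l' : ℝ≥0} {a b : X} (ha : X.Reg l a) (hb : X.Reg l' b) : X.Reg (l + l') (a - b) := by
  have h := ha.add (hb.real_smul (-1))
  simpa [sub_eq_add_neg] using h

theorem star {l : ℝ≥0} {a : X} (ha : X.Reg l a) : X.Reg l (star a) := by
  obtain ⟨x, y, hx, hy, rfl⟩ := ha
  refine ⟨x, -y, hx, (X.L_neg y).trans_le hy, ?_⟩
  rw [star_add, star_smul, (X.isSelfAdjoint_of_le hx).star_eq, (X.isSelfAdjoint_of_le hy).star_eq]
  simp

theorem map {l : ℝ≥0} {a : X} (ha : X.Reg l a) {π : X →⋆ₐ[ℂ] Y} {k : ℝ≥0}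
    (h : ∀ x, X.L x ≤ l → Y.L (π x) ≤ k) : Y.Reg k (π a) := by
  obtain ⟨x, y, hx, hy, rfl⟩ := ha
  exact ⟨π x, π y, h x hx, h y hy, by rw [map_add, map_smul]⟩

/-- Elements with finite Lipschitz seminorm are self-adjoint, so `x` and `y` are forced to be the
real and imaginary parts of `a`. -/
theorem exists_norm_le {l : ℝ≥0} {a : X} (ha : X.Reg l a) :
    ∃ x y : X, X.L x ≤ l ∧ X.L y ≤ l ∧ a = x + Complex.I • y ∧ ‖x‖ ≤ ‖a‖ ∧ ‖y‖ ≤ ‖a‖ := by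
  obtain ⟨x, y, hx, hy, rfl⟩ := ha
  have hxs := X.isSelfAdjoint_of_le hx
  have hys := X.isSelfAdjoint_of_le hy
  refine ⟨x, y, hx, hy, rfl, ?_, ?_⟩
  · have h : x = (realPart (x + Complex.I • y) : X) := by
      rw [map_add, realPart_I_smul, hys.imaginaryPart, neg_zero, add_zero, hxs.coe_realPart]
    exact (congrArg norm h).trans_le (realPart.norm_le (x + Complex.I • y))
  · have h : y = (imaginaryPart (x + Complex.I • y) : X) := by
      rw [map_add, imaginaryPart_I_smul, hxs.imaginaryPart, zero_add, hys.coe_realPart]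
    exact (congrArg norm h).trans_le (imaginaryPart.norm_le (x + Complex.I • y))

/-- The product is the Jordan product plus `i` times the Lie product, and the Leibniz inequality
controls both. -/
theorem mul_of_L_le (hF : IsAdmissible F) {l M : ℝ≥0} (hfin : F M M l l < ⊤) {a b : X}
    (ha : X.L a ≤ l) (hb : X.L b ≤ l) (haM : ‖a‖ ≤ M) (hbM : ‖b‖ ≤ M) :
    X.Reg (F M M l l).toNNReal (a * b) := by
  have h1 := X.leibniz a b (ha.trans_lt ENNReal.coe_lt_top) (hb.trans_lt ENNReal.coe_lt_top)
  have hne : ∀ {c : X}, ‖c‖ ≤ M → ‖c‖ₑ ≤ M := fun {c} hc => by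
    rw [enorm_eq_nnnorm]
    exact_mod_cast hc
  have h2 := h1.trans (hF.mono _ _ _ _ _ _ _ _ (hne haM) (hne hbM) ha hb)
  rw [← ENNReal.coe_toNNReal hfin.ne] at h2
  refine ⟨jordanProd a b, lieProd a b, (le_max_left _ _).trans h2, (le_max_right _ _).trans h2, ?_⟩
  rw [jordanProd, lieProd, smul_smul]
  have : Complex.I * (1 / (2 * Complex.I)) = 1 / 2 := by field_simp
  rw [this]
  module

theorem mul (hF : IsAdmissible F) {l M : ℝ≥0} (hfin : F M M l l < ⊤) {a b : X}
    (ha : X.Reg l a) (hb : X.Reg l b) (haM : ‖a‖ ≤ M) (hbM : ‖b‖ ≤ M) :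
    X.Reg (4 * (F M M l l).toNNReal) (a * b) := by
  obtain ⟨x, y, hx, hy, hxy, hxM, hyM⟩ := ha.exists_norm_le
  obtain ⟨x', y', hx', hy', hxy', hxM', hyM'⟩ := hb.exists_norm_le
  have h1 := mul_of_L_le hF hfin hx hx' (hxM.trans haM) (hxM'.trans hbM)
  have h2 := (mul_of_L_le hF hfin hx hy' (hxM.trans haM) (hyM'.trans hbM)).I_smul
  have h3 := (mul_of_L_le hF hfin hy hx' (hyM.trans haM) (hxM'.trans hbM)).I_smul
  have h4 := (mul_of_L_le hF hfin hy hy' (hyM.trans haM) (hyM'.trans hbM)).I_smul.I_smul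
  have h := ((h1.add h2).add h3).add h4
  have e : a * b = x * x' + Complex.I • (x * y') + Complex.I • (y * x')
      + Complex.I • Complex.I • (y * y') := by
    rw [hxy, hxy']
    simp only [add_mul, mul_add, smul_mul_assoc, mul_smul_comm, smul_add]
    abel
  rw [e]
  exact h.mono (le_of_eq (by ring))

/-- Lifting regular elements along a quantum isometry. -/
theorem exists_lift {l l' : ℝ≥0} {a : Y} (ha : Y.Reg l a) (hl : l < l') {π : X →⋆ₐ[ℂ] Y}
    (h : IsQuantumIsometry X Y π) : ∃ d, π d = a ∧ X.Reg l' d := by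
  obtain ⟨x, y, hx, hy, rfl⟩ := ha
  have hl' : (l : ℝ≥0∞) < l' := ENNReal.coe_lt_coe.2 hl
  obtain ⟨d, rfl, hd⟩ := h.exists_lift (hx.trans_lt hl')
  obtain ⟨e, rfl, he⟩ := h.exists_lift (hy.trans_lt hl')
  exact ⟨d + Complex.I • e, by rw [map_add, map_smul], d, e, hd, he, rfl⟩

end Reg

/-- Regular elements are dense. -/
theorem exists_reg_norm_sub_le (X : QQCMS.{u} F) (b : X) {ε : ℝ} (hε : 0 < ε) :
    ∃ (l : ℝ≥0) (c : X), X.Reg l c ∧ ‖c - b‖ ≤ ε := by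
  have key : ∀ x : X, IsSelfAdjoint x → ∃ y, X.L y < ⊤ ∧ ‖y - x‖ < ε / 2 := by
    intro x hx
    obtain ⟨y, hy, hd⟩ := Metric.mem_closure_iff.1 (X.dense_dom x hx) (ε / 2) (half_pos hε)
    exact ⟨y, hy, by rwa [dist_comm, dist_eq_norm] at hd⟩
  obtain ⟨x, hx, hxb⟩ := key _ (realPart b).2
  obtain ⟨y, hy, hyb⟩ := key _ (imaginaryPart b).2
  lift X.L x to ℝ≥0 using hx.ne with l hl
  lift X.L y to ℝ≥0 using hy.ne with l' hl'
  refine ⟨max l l', x + Complex.I • y, ⟨x, y, ?_, ?_, rfl⟩, ?_⟩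
  · rw [← hl]; exact_mod_cast le_max_left _ _
  · rw [← hl']; exact_mod_cast le_max_right _ _
  · have e : x + Complex.I • y - b = (x - (realPart b : X)) + Complex.I • (y - (imaginaryPart b : X)) := by
      nth_rewrite 1 [← realPart_add_I_smul_imaginaryPart b]
      module
    rw [e]
    refine (norm_add_le _ _).trans ?_
    rw [norm_smul, Complex.norm_I, one_mul]
    linarith

end QQCMS

/-! ### The tracking relation: algebraic operations and uniqueness of limits. -/

namespace QQCMS

variable {F : ℝ≥0∞ → ℝ≥0∞ → ℝ≥0∞ → ℝ≥0∞ → ℝ≥0∞} {A : ℕ → QQCMS.{u} F} {B : QQCMS.{u} F}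
  {τ : ∀ n, Tunnel (A n) B} {U : Ultrafilter ℕ}

theorem Tunnel.norm_le_of_extent_lt {X Y : QQCMS.{u} F} (σ : Tunnel X Y) {m l : ℝ≥0}
    (h : σ.extent < m) {d : σ.D} (hd : σ.D.L d ≤ l) :
    ‖d‖ ≤ ‖σ.fst d‖ + l * m ∧ ‖d‖ ≤ ‖σ.snd d‖ + l * m :=
  ⟨norm_le_of_hausdorffEDist_lt _ σ.fst ((le_max_left _ _).trans_lt h) hd,
    norm_le_of_hausdorffEDist_lt _ σ.snd ((le_max_right _ _).trans_lt h) hd⟩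

theorem eventually_norm_le (hτ : Tendsto (fun n => (τ n).extent) U (𝓝 0)) (l : ℝ≥0) {ε : ℝ}
    (hε : 0 < ε) : ∀ᶠ n in U, ∀ d : (τ n).D, (τ n).D.L d ≤ l →
      ‖d‖ ≤ ‖(τ n).fst d‖ + ε ∧ ‖d‖ ≤ ‖(τ n).snd d‖ + ε := by
  obtain ⟨m, hm, hmε⟩ : ∃ m : ℝ≥0, 0 < m ∧ l * m ≤ ε := by
    refine ⟨Real.toNNReal (ε / (l + 1)), by positivity, ?_⟩
    rw [Real.coe_toNNReal _ (by positivity), mul_div_assoc', div_le_iff₀ (by positivity)]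
    nlinarith
  filter_upwards [hτ.eventually_lt_const (ENNReal.coe_pos.2 hm)] with n hn d hd
  obtain ⟨h1, h2⟩ := (τ n).norm_le_of_extent_lt hn hd
  exact ⟨h1.trans (by linarith), h2.trans (by linarith)⟩

/-- The factor 2 comes from treating real and imaginary parts separately. It is harmless for
boundedness and for smallness; sharp norm bounds go through self-adjoint elements instead. -/
theorem eventually_norm_le_of_reg (hτ : Tendsto (fun n => (τ n).extent) U (𝓝 0)) (l : ℝ≥0) {ε : ℝ}
    (hε : 0 < ε) : ∀ᶠ n in U, ∀ d : (τ n).D, (τ n).D.Reg l d →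
      ‖d‖ ≤ 2 * ‖(τ n).fst d‖ + ε ∧ ‖d‖ ≤ 2 * ‖(τ n).snd d‖ + ε := by
  filter_upwards [eventually_norm_le hτ l (half_pos hε)] with n hn d hd
  obtain ⟨x, y, hx, hy, rfl⟩ := hd
  have key : ∀ {Z : QQCMS.{u} F} (π : (τ n).D →⋆ₐ[ℂ] Z), ‖x‖ ≤ ‖π x‖ + ε / 2 →
      ‖y‖ ≤ ‖π y‖ + ε / 2 → ‖x + Complex.I • y‖ ≤ 2 * ‖π (x + Complex.I • y)‖ + ε := by
    intro Z π h1 h2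
    have hxs := ((τ n).D.isSelfAdjoint_of_le hx).map π
    have hys := ((τ n).D.isSelfAdjoint_of_le hy).map π
    have e1 : π x = (realPart (π (x + Complex.I • y)) : Z) := by
      rw [map_add, map_smul, map_add, realPart_I_smul, hys.imaginaryPart, neg_zero, add_zero,
        hxs.coe_realPart]
    have e2 : π y = (imaginaryPart (π (x + Complex.I • y)) : Z) := by
      rw [map_add, map_smul, map_add, imaginaryPart_I_smul, hxs.imaginaryPart, zero_add,
        hys.coe_realPart]
    have h3 : ‖π x‖ ≤ ‖π (x + Complex.I • y)‖ :=
      (congrArg norm e1).trans_le (realPart.norm_le (π (x + Complex.I • y)))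
    have h4 : ‖π y‖ ≤ ‖π (x + Complex.I • y)‖ :=
      (congrArg norm e2).trans_le (imaginaryPart.norm_le (π (x + Complex.I • y)))
    refine (norm_add_le _ _).trans ?_
    rw [norm_smul, Complex.norm_I, one_mul]
    linarith
  exact ⟨key _ (hn x hx).1 (hn y hy).1, key _ (hn x hx).2 (hn y hy).2⟩

/-- A sequence `a n ∈ A n` tracks `b ∈ B` along `U` if, up to arbitrarily small errors, the pairs
`(a n, b)` lift to the tunnels with uniformly bounded Lipschitz seminorms. -/
def Tracks (τ : ∀ n, Tunnel (A n) B) (U : Ultrafilter ℕ) (a : ∀ n, A n) (b : B) : Prop :=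
  ∀ ε : ℝ, 0 < ε → ∃ (l : ℝ≥0) (d : ∀ n, (τ n).D), ∀ᶠ n in U,
    (τ n).D.Reg l (d n) ∧ ‖(τ n).fst (d n) - a n‖ ≤ ε ∧ ‖(τ n).snd (d n) - b‖ ≤ ε

theorem norm_starAlgHom_le {X Y : Type*} [CStarAlgebra X] [CStarAlgebra Y] (π : X →⋆ₐ[ℂ] Y)
    (x : X) : ‖π x‖ ≤ ‖x‖ := NonUnitalStarAlgHom.norm_apply_le π x

theorem norm_mul_sub_mul_le {X : Type*} [CStarAlgebra X] {x y a b : X} {p q δ : ℝ} (hx : ‖x‖ ≤ p)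
    (hb : ‖b‖ ≤ q) (hxa : ‖x - a‖ ≤ δ) (hyb : ‖y - b‖ ≤ δ) : ‖x * y - a * b‖ ≤ δ * (p + q) := by
  have e : x * y - a * b = x * (y - b) + (x - a) * b := by noncomm_ring
  have hδ : 0 ≤ δ := (norm_nonneg _).trans hxa
  have hp : 0 ≤ p := (norm_nonneg _).trans hx
  calc ‖x * y - a * b‖ ≤ ‖x‖ * ‖y - b‖ + ‖x - a‖ * ‖b‖ := by
        rw [e]
        exact (norm_add_le _ _).trans (add_le_add (norm_mul_le _ _) (norm_mul_le _ _))
    _ ≤ p * δ + δ * q := add_le_add (mul_le_mul hx hyb (norm_nonneg _) hp)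
        (mul_le_mul hxa hb (norm_nonneg _) hδ)
    _ = δ * (p + q) := by ring

namespace Tracks

variable {a a' : ∀ n, A n} {b b' : B}

theorem of_approx (h : ∀ ε : ℝ, 0 < ε → ∃ (a' : ∀ n, A n) (b' : B), Tracks τ U a' b' ∧
    (∀ᶠ n in U, ‖a' n - a n‖ ≤ ε) ∧ ‖b' - b‖ ≤ ε) : Tracks τ U a b := by
  intro ε hε
  obtain ⟨a', b', ht, ha, hb⟩ := h (ε / 2) (half_pos hε)
  obtain ⟨l, d, hd⟩ := ht (ε / 2) (half_pos hε)
  refine ⟨l, d, ?_⟩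
  filter_upwards [hd, ha] with n hn han
  refine ⟨hn.1, ?_, ?_⟩
  · exact (norm_sub_le_norm_sub_add_norm_sub _ (a' n) _).trans (by linarith)
  · exact (norm_sub_le_norm_sub_add_norm_sub _ b' _).trans (by linarith)

theorem congr (h : Tracks τ U a b) (ha : ∀ᶠ n in U, a n = a' n) : Tracks τ U a' b := by
  intro ε hε
  obtain ⟨l, d, hd⟩ := h ε hε
  refine ⟨l, d, ?_⟩
  filter_upwards [hd, ha] with n hn han
  rwa [← han]

theorem of_lift {l : ℝ≥0} {d : ∀ n, (τ n).D} (hd : ∀ᶠ n in U, (τ n).D.Reg l (d n))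
    (hb : Tendsto (fun n => (τ n).snd (d n)) U (𝓝 b)) :
    Tracks τ U (fun n => (τ n).fst (d n)) b := by
  intro ε hε
  refine ⟨l, d, ?_⟩
  filter_upwards [hd, hb.eventually (Metric.closedBall_mem_nhds b hε)] with n hn hbn
  exact ⟨hn, by simpa using hε.le, by rwa [← dist_eq_norm]⟩

theorem add (h : Tracks τ U a b) (h' : Tracks τ U a' b') :
    Tracks τ U (fun n => a n + a' n) (b + b') := by
  intro ε hε
  obtain ⟨l, d, hd⟩ := h (ε / 2) (half_pos hε)
  obtain ⟨l', d', hd'⟩ := h' (ε / 2) (half_pos hε)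
  refine ⟨l + l', fun n => d n + d' n, ?_⟩
  filter_upwards [hd, hd'] with n hn hn'
  refine ⟨hn.1.add hn'.1, ?_, ?_⟩ <;> rw [map_add, add_sub_add_comm] <;>
    refine (norm_add_le _ _).trans ?_
  · linarith [hn.2.1, hn'.2.1]
  · linarith [hn.2.2, hn'.2.2]

theorem smul (h : Tracks τ U a b) (c : ℂ) : Tracks τ U (fun n => c • a n) (c • b) := by
  intro ε hε
  obtain ⟨l, d, hd⟩ := h (ε / (‖c‖ + 1)) (by positivity)
  refine ⟨‖c.re‖₊ * l + ‖c.im‖₊ * l, fun n => c • d n, ?_⟩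
  have key : ∀ t : ℝ, t ≤ ε / (‖c‖ + 1) → ‖c‖ * t ≤ ε := fun t ht => by
    have h1 : ‖c‖ * t ≤ ‖c‖ * (ε / (‖c‖ + 1)) := mul_le_mul_of_nonneg_left ht (norm_nonneg c)
    refine h1.trans ?_
    rw [mul_div_assoc', div_le_iff₀ (by positivity)]
    nlinarith
  filter_upwards [hd] with n hn
  refine ⟨hn.1.smul c, ?_, ?_⟩ <;> rw [map_smul, ← smul_sub, norm_smul]
  exacts [key _ hn.2.1, key _ hn.2.2]

theorem sub (h : Tracks τ U a b) (h' : Tracks τ U a' b') :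
    Tracks τ U (fun n => a n - a' n) (b - b') := by
  simpa [sub_eq_add_neg] using h.add (h'.smul (-1))

theorem star (h : Tracks τ U a b) : Tracks τ U (fun n => Star.star (a n)) (Star.star b) := by
  intro ε hε
  obtain ⟨l, d, hd⟩ := h ε hε
  refine ⟨l, fun n => Star.star (d n), ?_⟩
  filter_upwards [hd] with n hn
  refine ⟨hn.1.star, ?_, ?_⟩ <;> rw [map_star, ← star_sub, norm_star]
  exacts [hn.2.1, hn.2.2]

theorem one : Tracks τ U (fun _ => 1) 1 := by
  intro ε hε
  refine ⟨0, fun _ => 1, Eventually.of_forall fun n => ⟨Reg.of_L_le ?_, ?_, ?_⟩⟩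
  · have := (τ n).D.L_real_smul_one 1
    simp_all
  · simpa using hε.le
  · simpa using hε.le

theorem norm_le (hτ : Tendsto (fun n => (τ n).extent) U (𝓝 0)) (h : Tracks τ U a b) {M : ℝ}
    (ha : ∀ᶠ n in U, ‖a n‖ ≤ M) : ‖b‖ ≤ 2 * M := by
  refine le_of_forall_pos_le_add fun ε hε => ?_
  obtain ⟨l, d, hd⟩ := h (ε / 4) (by positivity)
  obtain ⟨n, ⟨hr, h1, h2⟩, han, h3⟩ :=
    (hd.and (ha.and (eventually_norm_le_of_reg hτ l (ε := ε / 4) (by positivity)))).exists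
  have h4 := (h3 _ hr).1
  have h5 := norm_starAlgHom_le (τ n).snd (d n)
  have h6 := norm_sub_norm_le ((τ n).fst (d n)) (a n)
  have h7 := norm_sub_norm_le b ((τ n).snd (d n))
  rw [norm_sub_rev] at h7
  linarith

theorem eventually_norm_le (hτ : Tendsto (fun n => (τ n).extent) U (𝓝 0)) (h : Tracks τ U a b) :
    ∀ᶠ n in U, ‖a n‖ ≤ 2 * ‖b‖ + 4 := by
  obtain ⟨l, d, hd⟩ := h 1 one_pos
  filter_upwards [hd, eventually_norm_le_of_reg hτ l one_pos] with n hn h3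
  have h4 := (h3 _ hn.1).2
  have h5 := norm_starAlgHom_le (τ n).fst (d n)
  have h6 := norm_sub_norm_le ((τ n).snd (d n)) b
  have h7 := norm_sub_norm_le (a n) ((τ n).fst (d n))
  rw [norm_sub_rev] at h7
  linarith [hn.2.1, hn.2.2]

/-- The zero sequence tracks `b - b'`, and `norm_le` then forces it to vanish. -/
theorem unique (hτ : Tendsto (fun n => (τ n).extent) U (𝓝 0)) (h : Tracks τ U a b)
    (h' : Tracks τ U a b') : b = b' := by
  have := (h.sub h').norm_le hτ (M := 0) (Eventually.of_forall fun n => by simp)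
  rw [mul_zero] at this
  exact sub_eq_zero.1 (norm_le_zero_iff.1 this)

/-- Small extents bound the norms of the lifts in terms of `‖b‖` and `‖b'‖`, so `F`, finite at
finite arguments, gives one Lipschitz bound for all products of lifts. -/
theorem mul (hF : IsAdmissible F) (hFfin : ∀ x y lx ly : ℝ≥0, F x y lx ly < ⊤)
    (hτ : Tendsto (fun n => (τ n).extent) U (𝓝 0)) (h : Tracks τ U a b) (h' : Tracks τ U a' b') :
    Tracks τ U (fun n => a n * a' n) (b * b') := by
  intro ε hε
  have hε' : 0 < min 1 (ε / (4 * (‖b‖ + ‖b'‖ + 2))) := lt_min one_pos (by positivity)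
  obtain ⟨l, d, hd⟩ := h _ hε'
  obtain ⟨l', d', hd'⟩ := h' _ hε'
  set δ := min 1 (ε / (4 * (‖b‖ + ‖b'‖ + 2)))
  have hδ1 : δ ≤ 1 := min_le_left _ _
  have hδε : δ * (4 * (‖b‖ + ‖b'‖ + 2)) ≤ ε := by
    rw [← le_div_iff₀ (by positivity)]
    exact min_le_right _ _
  set M : ℝ≥0 := 2 * ‖b‖₊ + 2 * ‖b'‖₊ + 3
  have hM : (M : ℝ) = 2 * ‖b‖ + 2 * ‖b'‖ + 3 := rfl
  refine ⟨4 * (F M M (max l l' : ℝ≥0) (max l l' : ℝ≥0)).toNNReal, fun n => d n * d' n, ?_⟩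
  filter_upwards [hd, hd', eventually_norm_le_of_reg hτ l one_pos,
    eventually_norm_le_of_reg hτ l' one_pos] with n hn hn' h3 h3'
  have hdM : ‖d n‖ ≤ 2 * ‖b‖ + 3 := by
    linarith [(h3 _ hn.1).2, norm_sub_norm_le ((τ n).snd (d n)) b, hn.2.2]
  have hdM' : ‖d' n‖ ≤ 2 * ‖b'‖ + 3 := by
    linarith [(h3' _ hn'.1).2, norm_sub_norm_le ((τ n).snd (d' n)) b', hn'.2.2]
  refine ⟨(hn.1.mono (le_max_left l l')).mul hF (M := M) (hFfin _ _ _ _)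
    (hn'.1.mono (le_max_right l l')) ?_ ?_, ?_, ?_⟩
  · linarith [norm_nonneg b']
  · linarith [norm_nonneg b]
  · rw [map_mul]
    refine (norm_mul_sub_mul_le ((norm_starAlgHom_le (τ n).fst _).trans hdM) (q := 2 * ‖b'‖ + 4) ?_
      hn.2.1 hn'.2.1).trans (le_trans ?_ hδε)
    · have h4 := norm_sub_norm_le (a' n) ((τ n).fst (d' n))
      rw [norm_sub_rev] at h4
      linarith [norm_starAlgHom_le (τ n).fst (d' n), hn'.2.1]
    · exact mul_le_mul_of_nonneg_left (by linarith [norm_nonneg b, norm_nonneg b']) hε'.le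
  · rw [map_mul]
    refine (norm_mul_sub_mul_le ((norm_starAlgHom_le (τ n).snd _).trans hdM) le_rfl
      hn.2.2 hn'.2.2).trans (le_trans ?_ hδε)
    exact mul_le_mul_of_nonneg_left (by linarith [norm_nonneg b, norm_nonneg b']) hε'.le

/-- Lifts of a tracking sequence with bounded Lipschitz seminorms converge. -/
theorem tendsto_lift (hτ : Tendsto (fun n => (τ n).extent) U (𝓝 0)) (h : Tracks τ U a b)
    {l : ℝ≥0} {e : ∀ n, (τ n).D} (he : ∀ᶠ n in U, (τ n).D.Reg l (e n))
    (hea : ∀ᶠ n in U, (τ n).fst (e n) = a n) :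
    Tendsto (fun n => (τ n).snd (e n)) U (𝓝 b) := by
  refine Metric.tendsto_nhds.2 fun ε hε => ?_
  obtain ⟨l', d, hd⟩ := h (ε / 5) (by positivity)
  filter_upwards [hd, he, hea,
    -- The lifts `e n` and `d n` have nearly equal first images and a bounded Lipschitz difference,
    -- so they are within `3 * ε / 5` of each other in the tunnel.
    eventually_norm_le_of_reg hτ (l + l') (ε := ε / 5) (by positivity)] with n hn hen hean h3
  have h4 := (h3 _ (hen.sub hn.1)).1
  rw [map_sub, hean, norm_sub_rev (a n)] at h4
  have h5 := norm_starAlgHom_le (τ n).snd (e n - d n)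
  rw [map_sub] at h5
  have h6 := norm_sub_le_norm_sub_add_norm_sub ((τ n).snd (e n)) ((τ n).snd (d n)) b
  rw [dist_eq_norm]
  linarith [hn.2.1, hn.2.2]

end Tracks
end QQCMS

/-! ### Existence of limits, and limit morphisms. -/

namespace QQCMS

variable {F : ℝ≥0∞ → ℝ≥0∞ → ℝ≥0∞ → ℝ≥0∞ → ℝ≥0∞} {A : ℕ → QQCMS.{u} F} {B : QQCMS.{u} F}
  {τ : ∀ n, Tunnel (A n) B} {U : Ultrafilter ℕ}

namespace Tracks

variable {a a' : ∀ n, A n} {b b' : B}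

theorem exists_lift {l l' : ℝ≥0} (hl : l < l') (ha : ∀ᶠ n in U, (A n).L (a n) ≤ l) :
    ∃ e : ∀ n, (τ n).D, ∀ᶠ n in U, (τ n).fst (e n) = a n ∧ (τ n).D.L (e n) ≤ l' := by
  have : ∀ n, ∃ e : (τ n).D, (A n).L (a n) ≤ l → (τ n).fst e = a n ∧ (τ n).D.L e ≤ l' := by
    intro n
    by_cases h : (A n).L (a n) ≤ l
    · obtain ⟨e, he⟩ := (τ n).fst_isometry.exists_lift (h.trans_lt (ENNReal.coe_lt_coe.2 hl))
      exact ⟨e, fun _ => he⟩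
    · exact ⟨0, fun h' => absurd h' h⟩
  choose e he using this
  exact ⟨e, ha.mono fun n hn => he n hn⟩

/-- The Lipschitz seminorm is lower semicontinuous under tracking. -/
theorem L_le (hτ : Tendsto (fun n => (τ n).extent) U (𝓝 0)) (h : Tracks τ U a b) {l : ℝ≥0}
    (ha : ∀ᶠ n in U, (A n).L (a n) ≤ l) : B.L b ≤ l := by
  refine ENNReal.le_of_forall_pos_le_add fun ε hε _ => ?_
  obtain ⟨e, he⟩ := exists_lift (τ := τ) (lt_add_of_pos_right l hε) ha
  have ht := h.tendsto_lift hτ (he.mono fun n hn => Reg.of_L_le hn.2) (he.mono fun n hn => hn.1)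
  rw [← ENNReal.coe_add]
  exact (B.lsc.isClosed_preimage _).mem_of_tendsto ht
    (he.mono fun n hn => ((τ n).snd_isometry.L_apply_le _).trans hn.2)

/-- A Lipschitz bound allows exact self-adjoint lifts, for which the norm comparison has constant 1
instead of 2. -/
theorem norm_le_of_L_le (hτ : Tendsto (fun n => (τ n).extent) U (𝓝 0)) (h : Tracks τ U a b)
    {l : ℝ≥0} {M : ℝ} (ha : ∀ᶠ n in U, (A n).L (a n) ≤ l) (haM : ∀ᶠ n in U, ‖a n‖ ≤ M) :
    ‖b‖ ≤ M := by
  refine le_of_forall_pos_le_add fun ε hε => ?_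
  obtain ⟨e, he⟩ := exists_lift (τ := τ) (lt_add_one l) ha
  have ht := h.tendsto_lift hτ (he.mono fun n hn => Reg.of_L_le hn.2) (he.mono fun n hn => hn.1)
  refine le_of_tendsto ht.norm ?_
  filter_upwards [he, haM, QQCMS.eventually_norm_le hτ (l + 1) hε] with n hn han h3
  have h4 := (h3 _ hn.2).1
  rw [hn.1] at h4
  linarith [norm_starAlgHom_le (τ n).snd (e n)]

theorem le_norm_of_L_le (hτ : Tendsto (fun n => (τ n).extent) U (𝓝 0)) (h : Tracks τ U a b)
    {l : ℝ≥0} {M : ℝ} (ha : ∀ᶠ n in U, (A n).L (a n) ≤ l) (haM : ∀ᶠ n in U, M ≤ ‖a n‖) :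
    M ≤ ‖b‖ := by
  refine le_of_forall_pos_le_add fun ε hε => ?_
  obtain ⟨e, he⟩ := exists_lift (τ := τ) (lt_add_one l) ha
  have ht := h.tendsto_lift hτ (he.mono fun n hn => Reg.of_L_le hn.2) (he.mono fun n hn => hn.1)
  refine ge_of_tendsto (ht.norm.add_const ε) ?_
  filter_upwards [he, haM, QQCMS.eventually_norm_le hτ (l + 1) hε] with n hn han h3
  have h4 := (h3 _ hn.2).2
  have h5 := norm_starAlgHom_le (τ n).fst (e n)
  rw [hn.1] at h5
  linarith

theorem exists_left_of_L_lt {l : ℝ≥0} (hb : B.L b < l) :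
    ∃ a : ∀ n, A n, Tracks τ U a b ∧ ∀ n, (A n).L (a n) ≤ l := by
  choose d hdb hdl using fun n => (τ n).snd_isometry.exists_lift hb
  refine ⟨fun n => (τ n).fst (d n), of_lift (Eventually.of_forall fun n => Reg.of_L_le (hdl n)) ?_,
    fun n => ((τ n).fst_isometry.L_apply_le _).trans (hdl n)⟩
  simp only [hdb]
  exact tendsto_const_nhds

/-- Bounded sequences with bounded Lipschitz seminorms track some element, by compactness. -/
theorem exists_right_of_L_le (hτ : Tendsto (fun n => (τ n).extent) U (𝓝 0)) {l : ℝ≥0} {M : ℝ}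
    (ha : ∀ᶠ n in U, (A n).L (a n) ≤ l) (haM : ∀ᶠ n in U, ‖a n‖ ≤ M) : ∃ b, Tracks τ U a b := by
  obtain ⟨e, he⟩ := exists_lift (τ := τ) (lt_add_one l) ha
  have hmem : ∀ᶠ n in U, (τ n).snd (e n) ∈ {b : B | B.L b ≤ (l + 1 : ℝ≥0) ∧ ‖b‖ ≤ M + 1} := by
    filter_upwards [he, haM, QQCMS.eventually_norm_le hτ (l + 1) one_pos] with n hn han h3
    have h4 := (h3 _ hn.2).1
    rw [hn.1] at h4
    exact ⟨((τ n).snd_isometry.L_apply_le _).trans hn.2,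
      (norm_starAlgHom_le (τ n).snd (e n)).trans (by linarith)⟩
  obtain ⟨b, -, hb⟩ := (B.isCompact_L_le_inter_norm_le (l + 1) (M + 1)).ultrafilter_le_nhds
    (U.map fun n => (τ n).snd (e n)) (le_principal_iff.2 hmem)
  exact ⟨b, (of_lift (he.mono fun n hn => Reg.of_L_le hn.2) hb).congr (he.mono fun n hn => hn.1)⟩

theorem exists_right_of_reg (hτ : Tendsto (fun n => (τ n).extent) U (𝓝 0)) {l : ℝ≥0} {M : ℝ}
    (ha : ∀ᶠ n in U, (A n).Reg l (a n)) (haM : ∀ᶠ n in U, ‖a n‖ ≤ M) : ∃ b, Tracks τ U a b := by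
  have : ∀ n, ∃ x y : A n, (A n).Reg l (a n) → (A n).L x ≤ l ∧ (A n).L y ≤ l ∧
      a n = x + Complex.I • y ∧ ‖x‖ ≤ ‖a n‖ ∧ ‖y‖ ≤ ‖a n‖ := by
    intro n
    by_cases h : (A n).Reg l (a n)
    · obtain ⟨x, y, hxy⟩ := h.exists_norm_le
      exact ⟨x, y, fun _ => hxy⟩
    · exact ⟨0, 0, fun h' => absurd h' h⟩
  choose x y hxy using this
  obtain ⟨b, hb⟩ := exists_right_of_L_le (a := x) hτ (ha.mono fun n hn => (hxy n hn).1)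
    ((ha.and haM).mono fun n hn => (hxy n hn.1).2.2.2.1.trans hn.2)
  obtain ⟨c, hc⟩ := exists_right_of_L_le (a := y) hτ (ha.mono fun n hn => (hxy n hn).2.1)
    ((ha.and haM).mono fun n hn => (hxy n hn.1).2.2.2.2.trans hn.2)
  exact ⟨b + Complex.I • c,
    (hb.add (hc.smul Complex.I)).congr (ha.mono fun n hn => (hxy n hn).2.2.1.symm)⟩

/-- The sequences which track some element are closed for uniform convergence. -/
theorem exists_right_of_approx (hτ : Tendsto (fun n => (τ n).extent) U (𝓝 0))
    (h : ∀ ε : ℝ, 0 < ε → ∃ (a' : ∀ n, A n) (b' : B), Tracks τ U a' b' ∧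
      ∀ᶠ n in U, ‖a' n - a n‖ ≤ ε) : ∃ b, Tracks τ U a b := by
  choose a' b' hab ha' using fun k : ℕ => h ((1 / 2) ^ k) (by positivity)
  -- The approximating sequences are all close to `a`, hence to one another, and this closeness
  -- passes to their limits.
  have hdist : ∀ j k : ℕ, ‖b' j - b' k‖ ≤ 2 * ((1 / 2) ^ j + (1 / 2) ^ k) := by
    intro j k
    refine ((hab j).sub (hab k)).norm_le hτ ?_
    filter_upwards [ha' j, ha' k] with n hj hk
    rw [norm_sub_rev] at hk
    exact (norm_sub_le_norm_sub_add_norm_sub _ (a n) _).trans (add_le_add hj hk)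
  have hpow : Tendsto (fun k : ℕ => ((1 : ℝ) / 2) ^ k) atTop (𝓝 0) :=
    tendsto_pow_atTop_nhds_zero_of_lt_one (by norm_num) (by norm_num)
  have hcauchy : CauchySeq b' := by
    refine cauchySeq_of_le_tendsto_0 (fun k => 4 * (1 / 2) ^ k) (fun j k N hj hk => ?_)
      (by simpa using hpow.const_mul 4)
    have h1 : ((1 : ℝ) / 2) ^ j ≤ (1 / 2) ^ N :=
      pow_le_pow_of_le_one (by norm_num) (by norm_num) hj
    have h2 : ((1 : ℝ) / 2) ^ k ≤ (1 / 2) ^ N :=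
      pow_le_pow_of_le_one (by norm_num) (by norm_num) hk
    rw [dist_eq_norm]
    linarith [hdist j k]
  obtain ⟨b, hb⟩ := cauchySeq_tendsto_of_complete hcauchy
  refine ⟨b, of_approx fun ε hε => ?_⟩
  obtain ⟨k, hk1, hk2⟩ := ((hpow.eventually_le_const hε).and
    (hb.eventually (Metric.closedBall_mem_nhds b hε))).exists
  exact ⟨a' k, b' k, hab k, (ha' k).mono fun n hn => hn.trans hk1, by rwa [← dist_eq_norm]⟩

/-- Every element is tracked by some sequence. -/
theorem exists_left (hτ : Tendsto (fun n => (τ n).extent) U (𝓝 0)) (hU : (U : Filter ℕ) ≤ atTop)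
    (b : B) : ∃ a : ∀ n, A n, Tracks τ U a b := by
  choose l c hl hc using fun k : ℕ => B.exists_reg_norm_sub_le b (ε := (1 / 2) ^ k) (by positivity)
  choose d hdc hdl using fun k n => (hl k).exists_lift (lt_add_one (l k)) (τ n).snd_isometry
  have htrack : ∀ k, Tracks τ U (fun n => (τ n).fst (d k n)) (c k) := fun k =>
    of_lift (Eventually.of_forall fun n => hdl k n) (by simp only [hdc]; exact tendsto_const_nhds)
  -- Diagonal argument: the Lipschitz bounds `l k` may grow with `k`, so at stage `n` the finest
  -- approximation still compatible with all coarser ones is used. The constant is `5 = 2 * (1 + 1)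
  -- + 1`: twice the distance from `c j` to `c k`, plus the error of the tunnel.
  let P : ℕ → ℕ → Prop := fun n k =>
    ∀ j ≤ k, ‖(τ n).fst (d j n) - (τ n).fst (d k n)‖ ≤ 5 * (1 / 2) ^ j
  have hP : ∀ k, ∀ᶠ n in U, P n k := by
    intro k
    refine (eventually_all_finite (Set.finite_Iic k)).2 fun j hj => ?_
    filter_upwards [eventually_norm_le_of_reg hτ ((l j + 1) + (l k + 1))
      (ε := (1 / 2) ^ j) (by positivity)] with n hn
    have h1 := (hn _ ((hdl j n).sub (hdl k n))).2
    have h2 := norm_starAlgHom_le (τ n).fst (d j n - d k n)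
    rw [map_sub, hdc, hdc] at h1
    rw [map_sub] at h2
    have h3 := norm_sub_le_norm_sub_add_norm_sub (c j) b (c k)
    have h4 := hc k
    rw [norm_sub_rev] at h4
    have h5 : ((1 : ℝ) / 2) ^ k ≤ (1 / 2) ^ j :=
      pow_le_pow_of_le_one (by norm_num) (by norm_num) hj
    linarith [hc j]
  classical
  refine ⟨fun n => (τ n).fst (d (Nat.findGreatest (P n) n) n), of_approx fun ε hε => ?_⟩
  have hpow : Tendsto (fun k : ℕ => 5 * ((1 : ℝ) / 2) ^ k) atTop (𝓝 0) := by
    simpa using (tendsto_pow_atTop_nhds_zero_of_lt_one (r := (1 : ℝ) / 2) (by norm_num)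
      (by norm_num)).const_mul 5
  obtain ⟨k, hk⟩ := (hpow.eventually_le_const hε).exists
  refine ⟨_, c k, htrack k, ?_, (hc k).trans (le_trans ?_ hk)⟩
  · filter_upwards [hP k, hU (eventually_ge_atTop k)] with n hn hkn
    exact (Nat.findGreatest_spec hkn hn k (Nat.le_findGreatest hkn hn)).trans hk
  · linarith [pow_pos (by norm_num : (0 : ℝ) < 1 / 2) k]

/-- The images of a tracking sequence by uniformly Lipschitz morphisms track some element. -/
theorem exists_right_map (hτ : Tendsto (fun n => (τ n).extent) U (𝓝 0)) (h : Tracks τ U a b)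
    {ρ : ∀ n, A n →⋆ₐ[ℂ] A n} {k : ℝ≥0}
    (hρ : ∀ᶠ n in U, ∀ x, (A n).L x < ⊤ → (A n).L (ρ n x) ≤ k * (A n).L x) :
    ∃ c, Tracks τ U (fun n => ρ n (a n)) c := by
  refine exists_right_of_approx hτ fun ε hε => ?_
  obtain ⟨l, d, hd⟩ := h ε hε
  have hreg : ∀ᶠ n in U, (A n).Reg (k * l) (ρ n ((τ n).fst (d n))) := by
    filter_upwards [hd, hρ] with n hn hρn
    refine (hn.1.map fun x hx => ((τ n).fst_isometry.L_apply_le x).trans hx).map fun x hx => ?_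
    rw [ENNReal.coe_mul]
    exact (hρn x (hx.trans_lt ENNReal.coe_lt_top)).trans (mul_le_mul' le_rfl hx)
  have hbdd : ∀ᶠ n in U, ‖ρ n ((τ n).fst (d n))‖ ≤ 2 * ‖b‖ + 4 + ε := by
    filter_upwards [hd, h.eventually_norm_le hτ] with n hn han
    linarith [norm_starAlgHom_le (ρ n) ((τ n).fst (d n)),
      norm_sub_norm_le ((τ n).fst (d n)) (a n), hn.2.1]
  obtain ⟨c, hc⟩ := exists_right_of_reg hτ hreg hbdd
  refine ⟨_, c, hc, hd.mono fun n hn => ?_⟩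
  rw [← map_sub]
  exact (norm_starAlgHom_le _ _).trans hn.2.1

end Tracks

/-- A sequence of uniformly Lipschitz endomorphisms has a limit along an ultrafilter. -/
theorem exists_limit_hom (hF : IsAdmissible F) (hFfin : ∀ x y lx ly : ℝ≥0, F x y lx ly < ⊤)
    (hτ : Tendsto (fun n => (τ n).extent) U (𝓝 0)) (hU : (U : Filter ℕ) ≤ atTop)
    {ρ : ∀ n, A n →⋆ₐ[ℂ] A n} {k : ℝ≥0}
    (hρ : ∀ᶠ n in U, ∀ x, (A n).L x < ⊤ → (A n).L (ρ n x) ≤ k * (A n).L x) :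
    ∃ f : B →⋆ₐ[ℂ] B, ∀ a b, Tracks τ U a b → Tracks τ U (fun n => ρ n (a n)) (f b) := by
  choose s hs using Tracks.exists_left (τ := τ) hτ hU
  choose f hf using fun b => (hs b).exists_right_map hτ hρ
  have key : ∀ a b, Tracks τ U a b → Tracks τ U (fun n => ρ n (a n)) (f b) := by
    intro a b h
    refine Tracks.of_approx fun ε hε => ⟨_, f b, hf b, ?_, by simpa using hε.le⟩
    -- The chosen sequence and `a` differ by a sequence tracking zero, hence small in norm along
    -- `U`; the contractions `ρ n` keep it small.
    obtain ⟨l, d, hd⟩ := ((hs b).sub h) (ε / 4) (by positivity)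
    filter_upwards [hd, eventually_norm_le_of_reg hτ l (ε := ε / 4) (by positivity)] with n hn hn'
    rw [← map_sub]
    refine (norm_starAlgHom_le _ _).trans ?_
    have h1 := norm_sub_norm_le (s b n - a n) ((τ n).fst (d n))
    rw [norm_sub_rev (s b n - a n)] at h1
    have h2 := norm_starAlgHom_le (τ n).fst (d n)
    have h3 := hn.2.2
    rw [sub_self, sub_zero] at h3
    linarith [(hn' _ hn.1).2, hn.2.1]
  refine ⟨{ toFun := f, map_one' := ?_, map_mul' := ?_, map_zero' := ?_, map_add' := ?_,
            commutes' := ?_, map_star' := ?_ }, key⟩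
  · refine (key _ _ Tracks.one).unique hτ ?_
    simpa using Tracks.one (τ := τ) (U := U)
  · intro b c
    refine (key _ _ ((hs b).mul hF hFfin hτ (hs c))).unique hτ ?_
    simpa using (hf b).mul hF hFfin hτ (hf c)
  · have h0 : Tracks τ U (fun _ => 0) 0 := by
      simpa using (Tracks.one (τ := τ) (U := U)).smul 0
    refine (key _ _ h0).unique hτ ?_
    simpa using h0
  · intro b c
    refine (key _ _ ((hs b).add (hs c))).unique hτ ?_
    simpa using (hf b).add (hf c)
  · intro z
    simp only [Algebra.algebraMap_eq_smul_one]
    have h0 := (Tracks.one (τ := τ) (U := U)).smul z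
    refine (key _ _ h0).unique hτ ?_
    simpa using h0
  · intro b
    refine (key _ _ (hs b).star).unique hτ ?_
    simpa [map_star] using (hf b).star

end QQCMS

/-! ### Monge–Kantorovich lengths in the limit, and limit actions. -/

namespace QQCMS

variable {F : ℝ≥0∞ → ℝ≥0∞ → ℝ≥0∞ → ℝ≥0∞ → ℝ≥0∞}

theorem enorm_sub_apply_le_mul_mkLength (X : QQCMS.{u} F) (φ : X ≃⋆ₐ[ℂ] X) {l : ℝ≥0} (hl : 0 < l)
    {a : X} (ha : X.L a ≤ l) : ‖a - φ a‖ₑ ≤ l * X.mkLength φ := by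
  have hinv : ‖((l⁻¹ : ℝ≥0) : ℝ)‖ₑ = (l⁻¹ : ℝ≥0) := by
    rw [enorm_eq_nnnorm, NNReal.nnnorm_eq]
  have hl0 : (l : ℝ≥0∞) ≠ 0 := ENNReal.coe_ne_zero.2 hl.ne'
  have h1 : X.L ((((l⁻¹ : ℝ≥0) : ℝ) : ℂ) • a) ≤ 1 := by
    rw [X.L_smul, hinv, ENNReal.coe_inv hl.ne']
    exact (mul_le_mul' le_rfl ha).trans_eq (ENNReal.inv_mul_cancel hl0 ENNReal.coe_ne_top)
  have h2 : ‖(((l⁻¹ : ℝ≥0) : ℝ) : ℂ) • a - φ ((((l⁻¹ : ℝ≥0) : ℝ) : ℂ) • a)‖ₑ ≤ X.mkLength φ :=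
    le_iSup₂ (f := fun (a : X) (_ : X.L a ≤ 1) => ‖a - φ a‖ₑ) _ h1
  have h3 : ‖(((l⁻¹ : ℝ≥0) : ℝ) : ℂ)‖ₑ = (l⁻¹ : ℝ≥0) := by
    rw [← hinv, ← ofReal_norm, ← ofReal_norm, Complex.norm_real]
  rw [map_smul, ← smul_sub, enorm_smul, h3, ENNReal.coe_inv hl.ne'] at h2
  calc ‖a - φ a‖ₑ = l * ((l : ℝ≥0∞)⁻¹ * ‖a - φ a‖ₑ) := by
        rw [← mul_assoc, ENNReal.mul_inv_cancel hl0 ENNReal.coe_ne_top, one_mul]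
    _ ≤ _ := mul_le_mul' le_rfl h2

theorem enorm_le_coe_iff {X : Type*} [SeminormedAddCommGroup X] {x : X} {r : ℝ≥0} :
    ‖x‖ₑ ≤ r ↔ ‖x‖ ≤ r := by
  rw [enorm_eq_nnnorm, ENNReal.coe_le_coe, ← NNReal.coe_le_coe, coe_nnnorm]

variable {A : ℕ → QQCMS.{u} F} {B : QQCMS.{u} F} {τ : ∀ n, Tunnel (A n) B} {U : Ultrafilter ℕ}
  {ρ : ∀ n, A n ≃⋆ₐ[ℂ] A n} {f : B ≃⋆ₐ[ℂ] B} {k : ℝ≥0}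

/-- A test element of `B` is tracked by elements of Lipschitz seminorm at most `l`, with `l > 1`
arbitrarily close to 1; these move by at most `l * c`, and so does their limit. -/
theorem mkLength_le_of_eventually_le (hτ : Tendsto (fun n => (τ n).extent) U (𝓝 0))
    (hρ : ∀ᶠ n in U, ∀ x, (A n).L x < ⊤ → (A n).L (ρ n x) ≤ k * (A n).L x)
    (hf : ∀ a b, Tracks τ U a b → Tracks τ U (fun n => ρ n (a n)) (f b)) {c : ℝ≥0∞}
    (h : ∀ᶠ n in U, (A n).mkLength (ρ n) ≤ c) : B.mkLength f ≤ c := by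
  refine iSup₂_le fun b hb => ?_
  rcases eq_or_ne c ⊤ with rfl | hc
  · exact le_top
  lift c to ℝ≥0 using hc
  refine ENNReal.le_of_forall_pos_le_add fun ε hε _ => ?_
  obtain ⟨l, hl1, hlε⟩ : ∃ l : ℝ≥0, 1 < l ∧ l * c ≤ c + ε := by
    refine ⟨1 + ε / (c + 1), lt_add_of_pos_right 1 (by positivity), ?_⟩
    rw [add_mul, one_mul, div_mul_eq_mul_div]
    gcongr
    rw [div_le_iff₀ (by positivity)]
    gcongr
    exact le_self_add
  obtain ⟨a, hab, ha⟩ := Tracks.exists_left_of_L_lt (τ := τ) (U := U)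
    (hb.trans_lt (ENNReal.one_lt_coe_iff.2 hl1))
  rw [← ENNReal.coe_add]
  refine enorm_le_coe_iff.2 (le_trans ?_ (NNReal.coe_le_coe.2 hlε))
  refine (hab.sub (hf a b hab)).norm_le_of_L_le hτ (l := l + k * l) ?_ ?_
  · filter_upwards [hρ] with n hn
    refine ((A n).L_sub_le _ _).trans ?_
    rw [ENNReal.coe_add, ENNReal.coe_mul]
    exact add_le_add (ha n)
      ((hn _ ((ha n).trans_lt ENNReal.coe_lt_top)).trans (mul_le_mul' le_rfl (ha n)))
  · filter_upwards [h] with n hn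
    refine enorm_le_coe_iff.1 ?_
    rw [ENNReal.coe_mul]
    exact ((A n).enorm_sub_apply_le_mul_mkLength _ (one_pos.trans hl1) (ha n)).trans
      (mul_le_mul' le_rfl hn)

/-- Test elements of `A n` moved by more than `c` are made norm bounded by subtracting scalars,
which the automorphisms fix; by compactness they then track a test element of `B`. -/
theorem le_mkLength_of_eventually_lt (hτ : Tendsto (fun n => (τ n).extent) U (𝓝 0))
    (hρ : ∀ᶠ n in U, ∀ x, (A n).L x < ⊤ → (A n).L (ρ n x) ≤ k * (A n).L x)
    (hf : ∀ a b, Tracks τ U a b → Tracks τ U (fun n => ρ n (a n)) (f b)) {c : ℝ≥0∞}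
    (h : ∀ᶠ n in U, c < (A n).mkLength (ρ n)) : c ≤ B.mkLength f := by
  obtain ⟨M, hM⟩ := B.exists_norm_sub_smul_one_le
  lift c to ℝ≥0 using (h.exists.choose_spec.trans_le le_top).ne
  have key : ∀ᶠ n in U, ∃ a : A n, (A n).L a ≤ 1 ∧ ‖a‖ ≤ 2 * M + 1 ∧ (c : ℝ) ≤ ‖a - ρ n a‖ := by
    filter_upwards [h, eventually_norm_le hτ 2 one_pos] with n hn hn'
    obtain ⟨a, ha, hca⟩ : ∃ a : A n, (A n).L a ≤ 1 ∧ (c : ℝ≥0∞) < ‖a - ρ n a‖ₑ := by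
      obtain ⟨a, ha⟩ := lt_iSup_iff.1 hn
      obtain ⟨ha1, ha2⟩ := lt_iSup_iff.1 ha
      exact ⟨a, ha1, ha2⟩
    -- The scalar is found in `B`, whose constant `M` does not depend on `n`, and the bound returns
    -- to `A n` through the tunnel.
    obtain ⟨e, rfl, he⟩ := (τ n).fst_isometry.exists_lift
      (ha.trans_lt (ENNReal.one_lt_coe_iff.2 (one_lt_two (α := ℝ≥0))))
    obtain ⟨r, hr⟩ := hM 2 _ (((τ n).snd_isometry.L_apply_le e).trans he)
    refine ⟨(τ n).fst e - (r : ℂ) • 1, ?_, ?_, ?_⟩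
    · refine ((A n).L_sub_le _ _).trans ?_
      rwa [L_real_smul_one, add_zero]
    · have h1 : (τ n).D.L (e - (r : ℂ) • 1) ≤ (2 : ℝ≥0) := by
        refine ((τ n).D.L_sub_le _ _).trans ?_
        rwa [L_real_smul_one, add_zero]
      have h2 := (hn' _ h1).2
      have h3 := norm_starAlgHom_le (τ n).fst (e - (r : ℂ) • 1)
      rw [map_sub, map_smul, map_one] at h2 h3
      exact h3.trans (h2.trans (add_le_add hr le_rfl))
    · have e1 : (τ n).fst e - (r : ℂ) • 1 - ρ n ((τ n).fst e - (r : ℂ) • 1)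
          = (τ n).fst e - ρ n ((τ n).fst e) := by
        rw [map_sub, map_smul, map_one]
        abel
      rw [e1]
      exact not_lt.1 fun hlt => hca.not_ge (enorm_le_coe_iff.2 hlt.le)
  have : ∀ n, ∃ a : A n, (∃ a : A n, (A n).L a ≤ 1 ∧ ‖a‖ ≤ 2 * M + 1 ∧ (c : ℝ) ≤ ‖a - ρ n a‖) →
      (A n).L a ≤ 1 ∧ ‖a‖ ≤ 2 * M + 1 ∧ (c : ℝ) ≤ ‖a - ρ n a‖ := fun n => by
    by_cases hn : ∃ a : A n, (A n).L a ≤ 1 ∧ ‖a‖ ≤ 2 * M + 1 ∧ (c : ℝ) ≤ ‖a - ρ n a‖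
    · exact ⟨hn.choose, fun _ => hn.choose_spec⟩
    · exact ⟨0, fun h' => absurd h' hn⟩
  choose a ha using this
  have ha' : ∀ᶠ n in U, (A n).L (a n) ≤ 1 ∧ ‖a n‖ ≤ 2 * M + 1 ∧ (c : ℝ) ≤ ‖a n - ρ n (a n)‖ :=
    key.mono fun n hn => ha n hn
  have haL : ∀ᶠ n in U, (A n).L (a n) ≤ (1 : ℝ≥0) := ha'.mono fun n hn => by simpa using hn.1
  obtain ⟨b, hb⟩ := Tracks.exists_right_of_L_le hτ haL (ha'.mono fun n hn => hn.2.1)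
  have hbL : B.L b ≤ 1 := by simpa using hb.L_le hτ haL
  have hcb : (c : ℝ) ≤ ‖b - f b‖ := by
    refine (hb.sub (hf a b hb)).le_norm_of_L_le hτ (l := 1 + k) ?_ (ha'.mono fun n hn => hn.2.2)
    filter_upwards [hρ, haL] with n hn han
    refine ((A n).L_sub_le _ _).trans ?_
    rw [ENNReal.coe_add]
    refine add_le_add han ((hn _ (han.trans_lt ENNReal.coe_lt_top)).trans ?_)
    exact (mul_le_mul' le_rfl han).trans_eq (by simp)
  refine le_trans ?_ (le_iSup₂ (f := fun (a : B) (_ : B.L a ≤ 1) => ‖a - f a‖ₑ) b hbL)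
  rw [enorm_eq_nnnorm, ENNReal.coe_le_coe]
  exact hcb

/-- A multiplicative family of limits of *-automorphisms is an action by *-automorphisms. -/
theorem exists_limit_action {G : Type*} [Group G] (hF : IsAdmissible F)
    (hFfin : ∀ x y lx ly : ℝ≥0, F x y lx ly < ⊤)
    (hτ : Tendsto (fun n => (τ n).extent) U (𝓝 0)) (hU : (U : Filter ℕ) ≤ atTop)
    {ρ : ∀ n, G → (A n ≃⋆ₐ[ℂ] A n)} {k : G → ℝ≥0}
    (hρ : ∀ g, ∀ᶠ n in U, ∀ x, (A n).L x < ⊤ → (A n).L (ρ n g x) ≤ k g * (A n).L x)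
    (hone : ∀ᶠ n in U, ρ n 1 = 1) (hmul : ∀ g h, ∀ᶠ n in U, ρ n (g * h) = ρ n g * ρ n h) :
    ∃ β : G →* (B ≃⋆ₐ[ℂ] B), ∀ g a b, Tracks τ U a b →
      Tracks τ U (fun n => ρ n g (a n)) (β g b) := by
  have h0 := fun g => exists_limit_hom (τ := τ) (ρ := fun n => (ρ n g).toStarAlgHom) hF hFfin hτ hU
    (hρ g)
  choose f hf using h0
  have hf1 : ∀ b, f 1 b = b := by
    intro b
    obtain ⟨a, ha⟩ := Tracks.exists_left hτ hU b
    refine (hf 1 a b ha).unique hτ (ha.congr (hone.mono fun n hn => ?_))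
    change a n = ρ n 1 (a n)
    rw [hn, StarAlgEquiv.one_apply]
  have hfmul : ∀ g h b, f (g * h) b = f g (f h b) := by
    intro g h b
    obtain ⟨a, ha⟩ := Tracks.exists_left hτ hU b
    refine (hf _ a b ha).unique hτ ((hf g _ _ (hf h a b ha)).congr ((hmul g h).mono fun n hn => ?_))
    change ρ n g (ρ n h (a n)) = ρ n (g * h) (a n)
    rw [hn, StarAlgEquiv.mul_apply]
  -- Invertibility of the limit morphisms comes from the group law: `f g⁻¹` inverts `f g`.
  have hinv : ∀ g h : G, g * h = 1 → (f g).comp (f h) = .id ℂ B := fun g h hgh =>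
    StarAlgHom.ext fun b => by rw [StarAlgHom.comp_apply, ← hfmul, hgh, hf1]; rfl
  refine ⟨⟨⟨fun g => StarAlgEquiv.ofStarAlgHom (f g) (f g⁻¹) (hinv _ _ (inv_mul_cancel g))
    (hinv _ _ (mul_inv_cancel g)), StarAlgEquiv.ext hf1⟩, fun g h => StarAlgEquiv.ext (hfmul g h)⟩,
    fun g a b h => hf g a b h⟩

end QQCMS

/-- An action of a topological group which is continuous on the domain of the Lipschitz seminorm is
strongly continuous. -/
theorem QQCMS.continuous_action {F : ℝ≥0∞ → ℝ≥0∞ → ℝ≥0∞ → ℝ≥0∞ → ℝ≥0∞} (B : QQCMS.{u} F)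
    {G : Type*} [TopologicalSpace G] {K : G × G → ℝ≥0} (hKcont : Continuous K)
    (hKdiag : ∀ g, K (g, g) = 0) (β : G → (B ≃⋆ₐ[ℂ] B))
    (h : ∀ (g h : G) (b : B), B.L b < ⊤ → ‖β g b - β h b‖ₑ ≤ B.L b * K (g, h)) (b : B) :
    Continuous fun g => β g b := by
  have hdom : ∀ (l : ℝ≥0) (x : B), B.L x ≤ l → Continuous fun g => β g x := by
    intro l x hx
    refine continuous_iff_continuousAt.2 fun g₀ => tendsto_iff_norm_sub_tendsto_zero.2 ?_
    have hlim : Tendsto (fun g => ((l * K (g, g₀) : ℝ≥0) : ℝ)) (𝓝 g₀) (𝓝 0) := by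
      have hc : Continuous fun g => ((l * K (g, g₀) : ℝ≥0) : ℝ) := by fun_prop
      have := hc.tendsto g₀
      rwa [hKdiag, mul_zero, NNReal.coe_zero] at this
    refine squeeze_zero (fun _ => norm_nonneg _) (fun g => enorm_le_coe_iff.1 ?_) hlim
    rw [ENNReal.coe_mul]
    exact (h g g₀ x (hx.trans_lt ENNReal.coe_lt_top)).trans (mul_le_mul' hx le_rfl)
  -- Automorphisms are contractive, so approximating `b` by regular elements approximates its orbit
  -- map uniformly in `g`.
  refine continuous_of_uniform_approx_of_continuous fun u hu => ?_
  obtain ⟨ε, hε, hu⟩ := Metric.mem_uniformity_dist.1 hu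
  obtain ⟨l, c, ⟨x, y, hx, hy, rfl⟩, hc⟩ := B.exists_reg_norm_sub_le b (half_pos hε)
  refine ⟨fun g => β g (x + Complex.I • y), ?_, fun g => hu ?_⟩
  · simp only [map_add, map_smul]
    exact (hdom l x hx).add ((hdom l y hy).const_smul _)
  · rw [dist_eq_norm, ← map_sub]
    refine lt_of_le_of_lt (norm_starAlgHom_le (β g).toStarAlgHom _) ?_
    rw [norm_sub_rev]
    linarith

/-! ### The limit action on the propinquity limit. -/

theorem mainTheorem8
    (F : ℝ≥0∞ → ℝ≥0∞ → ℝ≥0∞ → ℝ≥0∞ → ℝ≥0∞) (hF : IsAdmissible F)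
    (hFfin : ∀ x y lx ly : ℝ≥0, F x y lx ly < ⊤)
    (𝒞 : Set (QQCMS.{u} F)) (h𝒞 : 𝒞.Nonempty)
    (𝒯 : ∀ A B : QQCMS.{u} F, Set (QQCMS.Tunnel A B)) (h𝒯 : QQCMS.IsAppropriate 𝒞 𝒯)
    -- the group, as an increasing union of topological groups, with the inductive limit topology
    {G : Type*} [Group G] (Gs : ℕ → Subgroup G)
    (hle : ∀ n, Gs n ≤ Gs (n + 1)) (hunion : ∀ g : G, ∃ n, g ∈ Gs n)
    (t : ∀ n, TopologicalSpace (Gs n))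
    (hgroup : ∀ n, @IsTopologicalGroup (Gs n) (t n) _)
    (hsep : ∀ n, @TopologicalSpace.SeparableSpace (Gs n) (t n))
    (hfirst : ∀ n, @FirstCountableTopology (Gs n) (t n))
    (hincl : ∀ n, Continuous[t n, t (n + 1)] (Subgroup.inclusion (hle n)))
    [tG : TopologicalSpace G] (htG : tG = inductiveLimitTopology Gs t)
    -- the spaces and the actions
    (A : ℕ → QQCMS.{u} F) (hA : ∀ n, A n ∈ 𝒞)
    (α : ∀ n, Gs n →* (A n ≃⋆ₐ[ℂ] A n))
    (D : G → ℝ≥0) (hDcont : Continuous D)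
    (hD : ∀ (n : ℕ) (g : Gs n) (a : A n), (A n).L a < ⊤ → (A n).L (α n g a) ≤ D g * (A n).L a)
    (K : G × G → ℝ≥0) (hKcont : Continuous K) (hKdiag : ∀ g, K (g, g) = 0)
    (hK : ∀ (n : ℕ) (g h : Gs n) (a : A n), (A n).L a < ⊤ →
      ‖α n h a - α n g a‖ₑ ≤ (A n).L a * K (h, g))
    -- the limit
    (B : QQCMS.{u} F) (hB : B ∈ 𝒞)
    (hlim : Tendsto (fun n => QQCMS.propinquity 𝒯 (A n) B) atTop (𝓝 0)) :
    ∃ β : G →* (B ≃⋆ₐ[ℂ] B),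
      (∀ b : B, Continuous fun g : G => β g b) ∧
      (∀ (g : G) (b : B), B.L b < ⊤ → B.L (β g b) ≤ D g * B.L b) ∧
      (∀ (g h : G) (b : B), B.L b < ⊤ → ‖β g b - β h b‖ₑ ≤ B.L b * K (g, h)) ∧
      (∀ (g : G) (N : ℕ) (hg : g ∈ Gs N),
        liminf (fun k : ℕ => (A (N + k)).mkLength
            (α (N + k) ⟨g, monotone_nat_of_le_succ hle (Nat.le_add_right N k) hg⟩)) atTop
          ≤ B.mkLength (β g) ∧
        B.mkLength (β g) ≤
          limsup (fun k : ℕ => (A (N + k)).mkLength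
            (α (N + k) ⟨g, monotone_nat_of_le_succ hle (Nat.le_add_right N k) hg⟩)) atTop) := by
  classical
  obtain ⟨τ, hτ⟩ : ∃ τ : ∀ n, QQCMS.Tunnel (A n) B,
      Tendsto (fun n => (τ n).extent) atTop (𝓝 0) := by
    have hex : ∀ n, ∃ σ : QQCMS.Tunnel (A n) B,
        σ.extent ≤ QQCMS.propinquity 𝒯 (A n) B + ((n : ℝ≥0∞) + 1)⁻¹ := by
      intro n
      have hpos : ((n : ℝ≥0∞) + 1)⁻¹ ≠ 0 :=
        ENNReal.inv_ne_zero.2 (ENNReal.add_ne_top.2 ⟨ENNReal.natCast_ne_top n, ENNReal.one_ne_top⟩)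
      rcases eq_or_ne (QQCMS.propinquity 𝒯 (A n) B) ⊤ with htop | htop
      · obtain ⟨σ, -⟩ := h𝒯.exists_tunnel (A n) (hA n) B hB
        exact ⟨σ, by simp [htop]⟩
      · obtain ⟨σ, hσ⟩ := iInf_lt_iff.1 (ENNReal.lt_add_right htop hpos)
        obtain ⟨-, hσ⟩ := iInf_lt_iff.1 hσ
        exact ⟨σ, hσ.le⟩
    choose τ hτ using hex
    refine ⟨τ, tendsto_of_tendsto_of_tendsto_of_le_of_le tendsto_const_nhds ?_
      (fun _ => zero_le) hτ⟩
    have h0 : Tendsto (fun n : ℕ => ((n : ℝ≥0∞) + 1)⁻¹) atTop (𝓝 0) := by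
      have := (tendsto_add_atTop_iff_nat 1).2 ENNReal.tendsto_inv_nat_nhds_zero
      simpa using this
    simpa using hlim.add h0
  let U : Ultrafilter ℕ := hyperfilter ℕ
  have hU : (U : Filter ℕ) ≤ atTop := Nat.hyperfilter_le_atTop
  have hτU := hτ.mono_left hU
  have hmono : Monotone Gs := monotone_nat_of_le_succ hle
  have hmem : ∀ g : G, ∀ᶠ n in U, g ∈ Gs n := by
    intro g
    obtain ⟨N, hN⟩ := hunion g
    exact hU ((eventually_ge_atTop N).mono fun n hn => hmono hn hN)
  -- The default value 1 is immaterial, since each `g` lies in `Gs n` for all large `n`.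
  let ρ : ∀ n, G → (A n ≃⋆ₐ[ℂ] A n) := fun n g => if h : g ∈ Gs n then α n ⟨g, h⟩ else 1
  have hρα : ∀ n g (h : g ∈ Gs n), ρ n g = α n ⟨g, h⟩ := fun n g h => dif_pos h
  have hρD : ∀ g, ∀ᶠ n in U, ∀ x, (A n).L x < ⊤ → (A n).L (ρ n g x) ≤ D g * (A n).L x := by
    intro g
    filter_upwards [hmem g] with n hn x hx
    rw [hρα n g hn]
    exact hD n ⟨g, hn⟩ x hx
  obtain ⟨β, hβ⟩ := QQCMS.exists_limit_action hF hFfin hτU hU hρD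
    (Eventually.of_forall fun n => (hρα n 1 (one_mem _)).trans (map_one (α n))) (by
      intro g h
      filter_upwards [hmem g, hmem h] with n hg hh
      rw [hρα n g hg, hρα n h hh, hρα n _ (mul_mem hg hh), ← map_mul]
      rfl)
  have hβK : ∀ (g h : G) (b : B), B.L b < ⊤ → ‖β g b - β h b‖ₑ ≤ B.L b * K (g, h) := by
    intro g h b hb
    lift B.L b to ℝ≥0 using hb.ne with l hl
    rw [← ENNReal.coe_mul]
    refine QQCMS.enorm_le_coe_iff.2 (le_of_forall_gt_imp_ge_of_dense fun r hr => ?_)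
    -- Sequences tracking `b` are available only with Lipschitz bounds `m > l`, hence the limit `m →
    -- l`.
    obtain ⟨m, hlm, hmr⟩ : ∃ m : ℝ≥0, l < m ∧ m * K (g, h) ≤ r := by
      have hc : Tendsto (fun m : ℝ≥0 => ((m * K (g, h) : ℝ≥0) : ℝ)) (𝓝[>] l)
          (𝓝 ((l * K (g, h) : ℝ≥0) : ℝ)) :=
        ((by fun_prop : Continuous fun m : ℝ≥0 => ((m * K (g, h) : ℝ≥0) : ℝ)).tendsto l).mono_left
          nhdsWithin_le_nhds
      obtain ⟨m, hm1, hm2⟩ :=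
        (Filter.Eventually.and (self_mem_nhdsWithin : ∀ᶠ m in 𝓝[>] l, m ∈ Set.Ioi l)
          (hc.eventually_le_const hr)).exists
      exact ⟨m, hm1, by exact_mod_cast hm2⟩
    obtain ⟨a, hab, ha⟩ := QQCMS.Tracks.exists_left_of_L_lt (τ := τ) (U := U)
      (hl ▸ ENNReal.coe_lt_coe.2 hlm)
    refine le_trans (((hβ g a b hab).sub (hβ h a b hab)).norm_le_of_L_le hτU
      (l := D g * m + D h * m) (M := ((m * K (g, h) : ℝ≥0) : ℝ)) ?_ ?_) (by exact_mod_cast hmr)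
    · filter_upwards [hρD g, hρD h] with n hg hh
      refine ((A n).L_sub_le _ _).trans ?_
      have hlt := (ha n).trans_lt ENNReal.coe_lt_top
      rw [ENNReal.coe_add, ENNReal.coe_mul, ENNReal.coe_mul]
      exact add_le_add ((hg _ hlt).trans (mul_le_mul' le_rfl (ha n)))
        ((hh _ hlt).trans (mul_le_mul' le_rfl (ha n)))
    · filter_upwards [hmem g, hmem h] with n hg hh
      rw [hρα n g hg, hρα n h hh]
      refine QQCMS.enorm_le_coe_iff.1 ?_
      rw [ENNReal.coe_mul]
      exact (hK n ⟨h, hh⟩ ⟨g, hg⟩ (a n) ((ha n).trans_lt ENNReal.coe_lt_top)).trans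
        (mul_le_mul' (ha n) le_rfl)
  refine ⟨β, B.continuous_action hKcont hKdiag β hβK, fun g b hb => ?_, hβK, fun g N hg => ?_⟩
  · lift B.L b to ℝ≥0 using hb.ne with l hl
    have hc : Tendsto (fun m : ℝ≥0 => ((D g * m : ℝ≥0) : ℝ≥0∞)) (𝓝[>] l)
        (𝓝 ((D g * l : ℝ≥0) : ℝ≥0∞)) :=
      ((by fun_prop : Continuous fun m : ℝ≥0 => ((D g * m : ℝ≥0) : ℝ≥0∞)).tendsto l).mono_left
        nhdsWithin_le_nhds
    rw [← ENNReal.coe_mul]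
    refine ge_of_tendsto hc (eventually_mem_nhdsWithin.mono fun m hm => ?_)
    obtain ⟨a, hab, ha⟩ := QQCMS.Tracks.exists_left_of_L_lt (τ := τ) (U := U)
      (hl ▸ ENNReal.coe_lt_coe.2 hm)
    refine (hβ g a b hab).L_le hτU ((hρD g).mono fun n hn => ?_)
    rw [ENNReal.coe_mul]
    exact (hn _ ((ha n).trans_lt ENNReal.coe_lt_top)).trans (mul_le_mul' le_rfl (ha n))
  · have hcongr : (fun k : ℕ => (A (N + k)).mkLength
        (α (N + k) ⟨g, monotone_nat_of_le_succ hle (Nat.le_add_right N k) hg⟩))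
        = fun k => (fun n => (A n).mkLength (ρ n g)) (k + N) := by
      funext k
      rw [← hρα (N + k) g, Nat.add_comm]
    rw [hcongr, liminf_nat_add (fun n => (A n).mkLength (ρ n g)) N,
      limsup_nat_add (fun n => (A n).mkLength (ρ n g)) N]
    -- Strict bounds by the lower and upper limits hold for all large `n`, hence along `U`, where
    -- the length comparisons apply.
    refine ⟨le_of_forall_lt fun c hc => ?_, le_of_forall_gt fun c hc => ?_⟩
    · obtain ⟨c', hcc', hc'⟩ := exists_between hc
      exact hcc'.trans_le (QQCMS.le_mkLength_of_eventually_lt hτU (hρD g) (hβ g)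
        (hU (eventually_lt_of_lt_liminf hc')))
    · obtain ⟨c', hc', hcc'⟩ := exists_between hc
      exact (QQCMS.mkLength_le_of_eventually_le hτU (hρD g) (hβ g)
        (hU ((eventually_lt_of_limsup_lt hc').mono fun n hn => hn.le))).trans_lt hcc'
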